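/- Let $\mathbf k$ be a field of characteristic zero. All operators are written on the right of their arguments (in a product the leftmost operator acts first), $\otimes=\otimes_{\mathbf k}$, and for a linear map $\tau:B\otimes B\to B\otimes B$ we write $\tau_i=\mathrm{id}^{\otimes(i-1)}\otimes\tau\otimes\mathrm{id}^{\otimes(n-i-1)}$ on $B^{\otimes n}$, $1\le i<n$. **Braided nonassociative Hopf algebras.** Let $B$ be a unital, not necessarily associative $\mathbf k$-algebra with multiplication $\mathbf m:B\otimes B\to B$, and also a coassociative counital coalgebra with coproduct $\Delta$ and counit $\varepsilon$. It is a *braided nonassociative Hopf algebra* if it is equipped with a linear map $\tau:B\otimes B\to B\otimes B$ and bilinear operations $(x,y)\mapsto x\backslash y$ and $(x,y)\mapsto x/y$ such that: * $\tau_1\tau_2\tau_1=\tau_2\tau_1\tau_2$ on $B^{\otimes 3}$; * $(\mathbf m\otimes\mathrm{id})\tau=\tau_2\tau_1(\mathrm{id}\otimes\mathbf m)$ and $(\mathrm{id}\otimes\mathbf m)\tau=\tau_1\tau_2(\mathbf m\otimes\mathrm{id})$; * $\tau(\varepsilon\otimes\mathrm{id})=\mathrm{id}\otimes\varepsilon$,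 $\ \tau(\mathrm{id}\otimes\varepsilon)=\varepsilon\otimes\mathrm{id}$, $\ \tau(\mathrm{id}\otimes\Delta)=(\Delta\otimes\mathrm{id})\tau_2\tau_1$, $\ \tau(\Delta\otimes\mathrm{id})=(\mathrm{id}\otimes\Delta)\tau_1\tau_2$; * $\Delta(1)=1\otimes1$ and $\Delta(ab)=\Delta(a)\Delta(b)$, where $B\otimes B$ is multiplied by $(a\otimes b)(c\otimes d)=\sum_i ac_i\otimes b_id$ with $(b\otimes c)\tau=\sum_i c_i\otimes b_i$; * in Sweedler's notation $\Delta(x)=\sum x_{(1)}\otimes x_{(2)}$, for all $x,y\in B$, $$\sum x_{(1)}\backslash(x_{(2)}y)=\varepsilon(x)y=\sum x_{(1)}(x_{(2)}\backslash y),\qquad \sum (y\,x_{(1)})/x_{(2)}=\varepsilon(x)y=\sum (y/x_{(1)})\,x_{(2)} .$$ The braiding $\tau$ is *involutive* if $\tau^2=\mathrm{id}$. An element $x\in B$ is *primitive* if $\Delta(x)=x\otimes1+1\otimes x$. An operation $T:B^{\otimes N}\to B$ is *primitive* if $T(u_1\otimes\cdots\otimes u_N)$ is primitive for all primitive $u_1,\dots,u_N\in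 B$. **The operations.** For $a\le b$ put $[a;b]=\tau_{b-1}\tau_{b-2}\cdots\tau_a$ (so $[a;a]=1$), and put $$\nu_r^{k,n}=[k;r+1][k+1;r+2]\cdots[k+n-r-1;n]\qquad(1\le k\le r\le n;\ \nu_r^{k,n}=1\text{ if }n=r).$$ Let $\mathrm{Sh}_n^r$ be the set of permutations $\pi$ of $\{1,\dots,n\}$ with $\pi(1)<\dots<\pi(r)$ and $\pi(r+1)<\dots<\pi(n)$. For $\pi\in\mathrm{Sh}_n^r$ put $[\pi]=[1;\pi(1)][2;\pi(2)]\cdots[r;\pi(r)]$, and let $[\pi]_{(t)}$ be obtained from $[\pi]$ by replacing every $\tau_i$ with $\tau_{t+i}$. Let $R_r:B^{\otimes r}\to B$, $u_1\otimes\cdots\otimes u_r\mapsto(\cdots((u_1u_2)u_3)\cdots)u_r$, with $R_1=\mathrm{id}$ and $R_0:\mathbf k\to B$, $1\mapsto1$. Let $\mathbf m_1=\mathbf m\otimes\mathrm{id}$ and $\mathbf m_2=\mathrm{id}\otimes\mathbf m$, as maps $B^{\otimes3}\to B^{\otimes2}$. The *braided Shestakov–Umirbaev operations* $P_{m,n}:B^{\otimes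 m}\otimes B^{\otimes n}\otimes B\to B$, $m,n\ge1$, are defined by induction on $m+n$: $P_{1,1}=(\mathbf m_1-\mathbf m_2)\mathbf m$ is the associator $x\otimes y\otimes z\mapsto(xy)z-x(yz)$, and for $m+n>2$ $$P_{m,n}=(R_m\otimes R_n\otimes\mathrm{id})P_{1,1}-\sum_{\substack{0\le r<m,\ 0\le s<n\\ r+s>0}}\ \sum_{\pi\in\mathrm{Sh}_m^r}\ \sum_{\sigma\in\mathrm{Sh}_n^s}[\pi]\,[\sigma]_{(m)}\,\nu_m^{r+1,m+s}\,(R_r\otimes R_s\otimes P_{m-r,n-s})\,\mathbf m_1\,\mathbf m .$$ **Theorem.** Let $B$ be a braided nonassociative Hopf algebra over $\mathbf k$ whose braiding $\tau$ is involutive. Then for all $m,n\ge1$ the operation $P_{m,n}$ is primitive. -/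

import Mathlib

open scoped TensorProduct

noncomputable section

namespace BraidedNA

/-! ### Words in the generators of the braid monoid

The generators `s₁, s₂, …` are represented by the numbers `1, 2, …`, and a product of generators by
the list of its factors, read from the left to the right. -/

/-- The braid `[a;b]`: it is `s_{b-1} s_{b-2} ⋯ s_a` if `a < b`, it is `1` if `a = b`, and it is
`s_b s_{b+1} ⋯ s_{a-1}` if `b < a`. -/
def seg (a b : ℕ) : List ℕ :=
  if a ≤ b then (List.range' a (b - a)).reverse else List.range' b (a - b)

/-- `ν_r^{k,n} = [k;r+1] [k+1;r+2] ⋯ [k+n-r-1;n]` (the empty product if `n ≤ r`). -/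
def nu (r k n : ℕ) : List ℕ :=
  (List.range (n - r)).flatMap fun j => seg (k + j) (r + 1 + j)

/-- The shift `f ↦ f_{(t)}`, which replaces every `s_i` by `s_{t+i}`. -/
def shiftWord (t : ℕ) (w : List ℕ) : List ℕ :=
  w.map fun i => t + i

/-- The set `Sh_n^r` of `r`-shuffles: permutations of `n` symbols that are increasing on the first
`r` symbols and increasing on the remaining `n - r` symbols. -/
def shuffles (r n : ℕ) : Finset (Equiv.Perm (Fin n)) :=
  Finset.univ.filter fun π =>
    (∀ i j : Fin n, i < j → j.val < r → π i < π j) ∧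
      (∀ i j : Fin n, r ≤ i.val → i < j → π i < π j)

/-- The braid `[π] = [1;π(1)] [2;π(2)] ⋯ [r;π(r)]` of an `r`-shuffle `π`. The symbols `1, …, n` are
the elements `0, …, n-1` of `Fin n`, which explains the `+ 1`. -/
def shuffleWord (r : ℕ) {n : ℕ} (π : Equiv.Perm (Fin n)) : List ℕ :=
  ((List.finRange n).take r).flatMap fun i => seg (i.val + 1) ((π i).val + 1)

section LocalAction

variable {k : Type*} {B : Type*} [Field k] [AddCommGroup B] [Module k B]

/-- For `i ≠ j`, the linear map that sends `a ⊗ b` to the tensor `x₁ ⊗ ⋯ ⊗ xₙ` in which the factor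
at `i` is replaced by `a` and the factor at `j` is replaced by `b`. -/
def insertPair {n : ℕ} (i j : Fin n) (hij : i ≠ j) (x : Fin n → B) : B ⊗[k] B →ₗ[k] ⨂[k]^n B :=
  TensorProduct.lift <| LinearMap.mk₂ k
    (fun a b => PiTensorProduct.tprod k (Function.update (Function.update x i a) j b))
    (fun a a' b => by
      simp only [Function.update_comm hij]
      exact MultilinearMap.map_update_add _ _ _ _ _)
    (fun c a b => by
      simp only [Function.update_comm hij]
      exact MultilinearMap.map_update_smul _ _ _ _ _)
    (fun a b b' => MultilinearMap.map_update_add _ _ _ _ _)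
    (fun c a b => MultilinearMap.map_update_smul _ _ _ _ _)

theorem insertPair_tmul {n : ℕ} (i j : Fin n) (hij : i ≠ j) (x : Fin n → B) (a b : B) :
    insertPair (k := k) i j hij x (a ⊗ₜ[k] b) =
      PiTensorProduct.tprod k (Function.update (Function.update x i a) j b) := rfl

theorem insertPair_update_left {n : ℕ} (i j : Fin n) (hij : i ≠ j) (x : Fin n → B) (c : B) :
    insertPair (k := k) i j hij (Function.update x i c) = insertPair i j hij x := by
  ext a b
  simp [insertPair_tmul]

theorem insertPair_update_right {n : ℕ} (i j : Fin n) (hij : i ≠ j) (x : Fin n → B) (c : B) :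
    insertPair (k := k) i j hij (Function.update x j c) = insertPair i j hij x := by
  ext a b
  simp [insertPair_tmul, Function.update_comm hij]

theorem insertPair_update_add {n : ℕ} (i j l : Fin n) (hij : i ≠ j) (hi : l ≠ i) (hj : l ≠ j)
    (x : Fin n → B) (c d : B) :
    insertPair (k := k) i j hij (Function.update x l (c + d)) =
      insertPair i j hij (Function.update x l c) + insertPair i j hij (Function.update x l d) := by
  ext a b
  simp [insertPair_tmul, Function.update_comm hi, Function.update_comm hj]

theorem insertPair_update_smul {n : ℕ} (i j l : Fin n) (hij : i ≠ j) (hi : l ≠ i) (hj : l ≠ j)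
    (x : Fin n → B) (c : k) (d : B) :
    insertPair (k := k) i j hij (Function.update x l (c • d)) =
      c • insertPair i j hij (Function.update x l d) := by
  ext a b
  simp [insertPair_tmul, Function.update_comm hi, Function.update_comm hj]

/-- The application of `τ` to the tensor factors at `i` and `j`, as a linear map on `B^{⊗n}`: it
sends `x₁ ⊗ ⋯ ⊗ xₙ` to the tensor obtained by putting the two tensor factors of `τ (xᵢ ⊗ xⱼ)` at the
places `i` and `j`. -/
def applyAt (τ : B ⊗[k] B →ₗ[k] B ⊗[k] B) {n : ℕ} (i j : Fin n) (hij : i ≠ j) :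
    ⨂[k]^n B →ₗ[k] ⨂[k]^n B :=
  PiTensorProduct.lift
    { toFun := fun x => insertPair i j hij x (τ (x i ⊗ₜ[k] x j))
      map_update_add' := by
        intro inst x l c d
        obtain rfl := Subsingleton.elim inst (instDecidableEqFin n)
        by_cases hi : l = i
        · subst hi
          simp [insertPair_update_left, Function.update_of_ne hij.symm, TensorProduct.add_tmul]
        · by_cases hj : l = j
          · subst hj
            simp [insertPair_update_right, Function.update_of_ne hij, TensorProduct.tmul_add]
          · simp [insertPair_update_add i j l hij hi hj, Function.update_of_ne (Ne.symm hi),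
              Function.update_of_ne (Ne.symm hj)]
      map_update_smul' := by
        intro inst x l c d
        obtain rfl := Subsingleton.elim inst (instDecidableEqFin n)
        by_cases hi : l = i
        · subst hi
          simp [insertPair_update_left, Function.update_of_ne hij.symm, ← TensorProduct.smul_tmul']
        · by_cases hj : l = j
          · subst hj
            simp [insertPair_update_right, Function.update_of_ne hij]
          · simp [insertPair_update_smul i j l hij hi hj, Function.update_of_ne (Ne.symm hi),
              Function.update_of_ne (Ne.symm hj)] }

/-- The operator `τ_i = id^{⊗(i-1)} ⊗ τ ⊗ id^{⊗(n-i-1)}` on `B^{⊗n}`, for `1 ≤ i < n` (and the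
identity for the other values of `i`, which never occur below). -/
def tauAt (τ : B ⊗[k] B →ₗ[k] B ⊗[k] B) (n i : ℕ) : ⨂[k]^n B →ₗ[k] ⨂[k]^n B :=
  if h : 1 ≤ i ∧ i < n then
    applyAt τ (⟨i - 1, by omega⟩ : Fin n) ⟨i, h.2⟩ (by simp only [ne_eq, Fin.mk.injEq]; omega)
  else LinearMap.id

/-- The local action of a word in the braid generators on `B^{⊗n}`. Operators are written on the
right of their arguments, so the leftmost letter of the word acts first. -/
def wordAction (τ : B ⊗[k] B →ₗ[k] B ⊗[k] B) (n : ℕ) : List ℕ → (⨂[k]^n B →ₗ[k] ⨂[k]^n B)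
  | [] => LinearMap.id
  | i :: w => wordAction τ n w ∘ₗ tauAt τ n i

/-- The identification `B^{⊗N} = B^{⊗a} ⊗ B^{⊗b}` for `N = a + b`. -/
def splitTensor (k B : Type*) [Field k] [AddCommGroup B] [Module k B] {N a b : ℕ}
    (h : N = a + b) : ⨂[k]^N B ≃ₗ[k] (⨂[k]^a B) ⊗[k] (⨂[k]^b B) :=
  (TensorPower.cast k B h).trans TensorPower.mulEquiv.symm

/-- The map `f ⊗ g ⊗ h` on `B^{⊗N} = B^{⊗a} ⊗ B^{⊗b} ⊗ B^{⊗c}`, for `N = a + b + c`. -/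
def tensorThree {N a b c : ℕ} (e : N = a + (b + c)) (f : ⨂[k]^a B →ₗ[k] B)
    (g : ⨂[k]^b B →ₗ[k] B) (h : ⨂[k]^c B →ₗ[k] B) : ⨂[k]^N B →ₗ[k] B ⊗[k] (B ⊗[k] B) :=
  TensorProduct.map f (TensorProduct.map g h ∘ₗ (splitTensor k B rfl).toLinearMap) ∘ₗ
    (splitTensor k B e).toLinearMap

/-- `τ₁ = τ ⊗ id` on `B ⊗ B ⊗ B`. -/
def tauOne (τ : B ⊗[k] B →ₗ[k] B ⊗[k] B) : B ⊗[k] (B ⊗[k] B) →ₗ[k] B ⊗[k] (B ⊗[k] B) :=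
  (TensorProduct.assoc k B B B).toLinearMap ∘ₗ τ.rTensor B ∘ₗ
    (TensorProduct.assoc k B B B).symm.toLinearMap

/-- `τ₂ = id ⊗ τ` on `B ⊗ B ⊗ B`. -/
def tauTwo (τ : B ⊗[k] B →ₗ[k] B ⊗[k] B) : B ⊗[k] (B ⊗[k] B) →ₗ[k] B ⊗[k] (B ⊗[k] B) :=
  τ.lTensor B

/-- `τ` is a braiding: `τ₁ τ₂ τ₁ = τ₂ τ₁ τ₂`. It need not be invertible. -/
def IsBraiding (τ : B ⊗[k] B →ₗ[k] B ⊗[k] B) : Prop :=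
  tauOne τ ∘ₗ tauTwo τ ∘ₗ tauOne τ = tauTwo τ ∘ₗ tauOne τ ∘ₗ tauTwo τ

/-- A braiding is involutive if `τ² = id`. -/
def IsInvolutive (τ : B ⊗[k] B →ₗ[k] B ⊗[k] B) : Prop :=
  τ ∘ₗ τ = LinearMap.id

end LocalAction

section Hopf

variable {k : Type*} {B : Type*} [Field k] [NonAssocRing B] [Module k B]
  [SMulCommClass k B B] [IsScalarTower k B B]

/-- `𝐦₁ = 𝐦 ⊗ id : B ⊗ B ⊗ B → B ⊗ B`. -/
def mulOne (k B : Type*) [Field k] [NonAssocRing B] [Module k B] [SMulCommClass k B B]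
    [IsScalarTower k B B] : B ⊗[k] (B ⊗[k] B) →ₗ[k] B ⊗[k] B :=
  (LinearMap.mul' k B).rTensor B ∘ₗ (TensorProduct.assoc k B B B).symm.toLinearMap

/-- `𝐦₂ = id ⊗ 𝐦 : B ⊗ B ⊗ B → B ⊗ B`. -/
def mulTwo (k B : Type*) [Field k] [NonAssocRing B] [Module k B] [SMulCommClass k B B]
    [IsScalarTower k B B] : B ⊗[k] (B ⊗[k] B) →ₗ[k] B ⊗[k] B :=
  (LinearMap.mul' k B).lTensor B

/-- A (unital, not necessarily associative) algebra with a braiding is a braided algebra if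
`(𝐦 ⊗ id) τ = τ₂ τ₁ (id ⊗ 𝐦)` and `(id ⊗ 𝐦) τ = τ₁ τ₂ (𝐦 ⊗ id)`, where the operators act from the
left to the right. -/
structure IsBraidedAlgebra (τ : B ⊗[k] B →ₗ[k] B ⊗[k] B) : Prop where
  braiding : IsBraiding τ
  mul_left : τ ∘ₗ mulOne k B = mulTwo k B ∘ₗ tauOne τ ∘ₗ tauTwo τ
  mul_right : τ ∘ₗ mulTwo k B = mulOne k B ∘ₗ tauTwo τ ∘ₗ tauOne τ

/-- `Δ ⊗ id : B ⊗ B → B ⊗ B ⊗ B`. -/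
def comulOne (k B : Type*) [Field k] [AddCommGroup B] [Module k B] [Coalgebra k B] :
    B ⊗[k] B →ₗ[k] B ⊗[k] (B ⊗[k] B) :=
  (TensorProduct.assoc k B B B).toLinearMap ∘ₗ (Coalgebra.comul (R := k) (A := B)).rTensor B

/-- `id ⊗ Δ : B ⊗ B → B ⊗ B ⊗ B`. -/
def comulTwo (k B : Type*) [Field k] [AddCommGroup B] [Module k B] [Coalgebra k B] :
    B ⊗[k] B →ₗ[k] B ⊗[k] (B ⊗[k] B) :=
  (Coalgebra.comul (R := k) (A := B)).lTensor B

/-- `ε ⊗ id : B ⊗ B → B`, after the identification `k ⊗ B = B`. -/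
def counitOne (k B : Type*) [Field k] [AddCommGroup B] [Module k B] [Coalgebra k B] :
    B ⊗[k] B →ₗ[k] B :=
  (TensorProduct.lid k B).toLinearMap ∘ₗ (Coalgebra.counit (R := k) (A := B)).rTensor B

/-- `id ⊗ ε : B ⊗ B → B`, after the identification `B ⊗ k = B`. -/
def counitTwo (k B : Type*) [Field k] [AddCommGroup B] [Module k B] [Coalgebra k B] :
    B ⊗[k] B →ₗ[k] B :=
  (TensorProduct.rid k B).toLinearMap ∘ₗ (Coalgebra.counit (R := k) (A := B)).lTensor B

/-- A (coassociative, counital) coalgebra with a braiding is a braided coalgebra if, with operators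
acting from the left to the right, `τ (ε ⊗ id) = id ⊗ ε`, `τ (id ⊗ ε) = ε ⊗ id`,
`τ (id ⊗ Δ) = (Δ ⊗ id) τ₂ τ₁` and `τ (Δ ⊗ id) = (id ⊗ Δ) τ₁ τ₂`. -/
structure IsBraidedCoalgebra [Coalgebra k B] (τ : B ⊗[k] B →ₗ[k] B ⊗[k] B) : Prop where
  braiding : IsBraiding τ
  counit_left : counitOne k B ∘ₗ τ = counitTwo k B
  counit_right : counitTwo k B ∘ₗ τ = counitOne k B
  comul_right : comulTwo k B ∘ₗ τ = tauOne τ ∘ₗ tauTwo τ ∘ₗ comulOne k B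
  comul_left : comulOne k B ∘ₗ τ = tauTwo τ ∘ₗ tauOne τ ∘ₗ comulTwo k B

/-- The multiplication of the braided tensor square: `(a ⊗ b)(c ⊗ d) = ∑ᵢ a cᵢ ⊗ bᵢ d`, where
`τ (b ⊗ c) = ∑ᵢ cᵢ ⊗ bᵢ`. -/
def braidedTensorMul (τ : B ⊗[k] B →ₗ[k] B ⊗[k] B) :
    (B ⊗[k] B) ⊗[k] (B ⊗[k] B) →ₗ[k] B ⊗[k] B :=
  TensorProduct.map (LinearMap.mul' k B) (LinearMap.mul' k B) ∘ₗ
    (TensorProduct.assoc k B B (B ⊗[k] B)).symm.toLinearMap ∘ₗ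
    (tauOne τ).lTensor B ∘ₗ
    (TensorProduct.assoc k B B (B ⊗[k] B)).toLinearMap

/-- A braided bialgebra: a braided algebra and a braided coalgebra, with the same braiding, whose
coproduct is a homomorphism of unital algebras from `B` to the braided tensor square of `B`. -/
structure IsBraidedBialgebra [Coalgebra k B] (τ : B ⊗[k] B →ₗ[k] B ⊗[k] B) : Prop where
  braidedAlgebra : IsBraidedAlgebra τ
  braidedCoalgebra : IsBraidedCoalgebra τ
  comul_one : Coalgebra.comul (R := k) (1 : B) = 1 ⊗ₜ[k] 1
  comul_mul : ∀ a b : B, Coalgebra.comul (R := k) (a * b) =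
    braidedTensorMul τ (Coalgebra.comul (R := k) a ⊗ₜ[k] Coalgebra.comul (R := k) b)

/-- A braided nonassociative Hopf algebra: a braided coassociative bialgebra with a left division
`x \ y = ldiv x y` and a right division `y / x = rdiv y x` such that, in Sweedler's notation,
`∑ x₍₁₎ \ (x₍₂₎ y) = ε(x) y = ∑ x₍₁₎ (x₍₂₎ \ y)` and
`∑ (y x₍₁₎) / x₍₂₎ = ε(x) y = ∑ (y / x₍₁₎) x₍₂₎`. -/
structure BraidedHopfAlgebra (k B : Type*) [Field k] [NonAssocRing B] [Module k B]
    [SMulCommClass k B B] [IsScalarTower k B B] [Coalgebra k B] where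
  braiding : B ⊗[k] B →ₗ[k] B ⊗[k] B
  ldiv : B →ₗ[k] B →ₗ[k] B
  rdiv : B →ₗ[k] B →ₗ[k] B
  isBraidedBialgebra : IsBraidedBialgebra braiding
  ldiv_mul : ∀ x y : B,
    TensorProduct.lift (ldiv.compl₂ ((LinearMap.mul k B).flip y)) (Coalgebra.comul (R := k) x) =
      Coalgebra.counit (R := k) x • y
  mul_ldiv : ∀ x y : B,
    TensorProduct.lift ((LinearMap.mul k B).compl₂ (ldiv.flip y)) (Coalgebra.comul (R := k) x) =
      Coalgebra.counit (R := k) x • y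
  mul_rdiv : ∀ x y : B,
    TensorProduct.lift (rdiv ∘ₗ LinearMap.mul k B y) (Coalgebra.comul (R := k) x) =
      Coalgebra.counit (R := k) x • y
  rdiv_mul : ∀ x y : B,
    TensorProduct.lift (LinearMap.mul k B ∘ₗ rdiv y) (Coalgebra.comul (R := k) x) =
      Coalgebra.counit (R := k) x • y

/-- An element `x` is primitive if `Δ(x) = x ⊗ 1 + 1 ⊗ x`. -/
def IsPrimitive (k : Type*) {B : Type*} [Field k] [NonAssocRing B] [Module k B] [Coalgebra k B]
    (x : B) : Prop :=
  Coalgebra.comul (R := k) x = x ⊗ₜ[k] 1 + 1 ⊗ₜ[k] x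

/-- An `N`-ary operation is primitive if it takes primitive values on primitive arguments. -/
def IsPrimitiveOperation [Coalgebra k B] {N : ℕ} (T : ⨂[k]^N B →ₗ[k] B) : Prop :=
  ∀ u : Fin N → B, (∀ i, IsPrimitive k (u i)) → IsPrimitive k (T (PiTensorProduct.tprod k u))

/-- The multilinear map `(u₁, …, u_r) ↦ (⋯((u₁ u₂) u₃) ⋯) u_r`. For `r = 0` its value is `1`, and
for `r = 1` its value is `1 · u₁ = u₁`. -/
def rightNormedMultilinear (k B : Type*) [Field k] [NonAssocRing B] [Module k B]
    [SMulCommClass k B B] [IsScalarTower k B B] :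
    (r : ℕ) → MultilinearMap k (fun _ : Fin r => B) B
  | 0 => MultilinearMap.constOfIsEmpty k _ 1
  | r + 1 => MultilinearMap.uncurryRight
      ((LinearMap.mul k B).compMultilinearMap (rightNormedMultilinear k B r))

/-- The parenthesis function `R_r : B^{⊗r} → B`, `u₁ ⊗ ⋯ ⊗ u_r ↦ (⋯((u₁ u₂) u₃) ⋯) u_r`. -/
def rightNormed (k B : Type*) [Field k] [NonAssocRing B] [Module k B]
    [SMulCommClass k B B] [IsScalarTower k B B] (r : ℕ) : ⨂[k]^r B →ₗ[k] B :=
  PiTensorProduct.lift (rightNormedMultilinear k B r)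

/-- The associator `P_{1,1} = (𝐦₁ - 𝐦₂) 𝐦`, `x ⊗ y ⊗ z ↦ (x y) z - x (y z)`. -/
def associatorMap (k B : Type*) [Field k] [NonAssocRing B] [Module k B] [SMulCommClass k B B]
    [IsScalarTower k B B] : B ⊗[k] (B ⊗[k] B) →ₗ[k] B :=
  LinearMap.mul' k B ∘ₗ (mulOne k B - mulTwo k B)

/-- The braided Shestakov–Umirbaev operations `P_{m,n} : B^{⊗m} ⊗ B^{⊗n} ⊗ B → B`, `m, n ≥ 1`. With
operators acting from the left to the right,
`P_{m,n} = (R_m ⊗ R_n ⊗ id) P_{1,1}`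
`  - ∑_{r,s} ∑_{π ∈ Sh_m^r} ∑_{σ ∈ Sh_n^s}`
`      [π] [σ]_{(m)} ν_m^{r+1,m+s} (R_r ⊗ R_s ⊗ P_{m-r,n-s}) 𝐦₁ 𝐦`,
where the sum is over `0 ≤ r < m` and `0 ≤ s < n` with `r + s > 0`. For `m = n = 1` the sum is
empty and the formula gives the associator. -/
def suOp (τ : B ⊗[k] B →ₗ[k] B ⊗[k] B) (m n : ℕ) : ⨂[k]^(m + n + 1) B →ₗ[k] B :=
  associatorMap k B ∘ₗ
      tensorThree (by omega) (rightNormed k B m) (rightNormed k B n)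
        (PiTensorProduct.subsingletonEquiv (0 : Fin 1)).toLinearMap -
    ∑ r : Fin m, ∑ s : Fin n,
      if _h : 0 < r.val + s.val then
        ∑ π ∈ shuffles r.val m, ∑ σ ∈ shuffles s.val n,
          LinearMap.mul' k B ∘ₗ mulOne k B ∘ₗ
            tensorThree (by omega) (rightNormed k B r.val) (rightNormed k B s.val)
              (suOp τ (m - r.val) (n - s.val)) ∘ₗ
            wordAction τ (m + n + 1)
              (shuffleWord r.val π ++ shiftWord m (shuffleWord s.val σ) ++
                nu m (r.val + 1) (m + s.val))
      else 0
termination_by m + n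
decreasing_by omega

end Hopf

end BraidedNA

end

/-! Write (x, y, z) for the associator, and divide it by the product of its first two arguments in
the sense of convolution: Q(x, y, z) = ∑ (x₁y₁) \ (x₂, y₂, z), where x₁ ⊗ y₁ and x₂ ⊗ y₂ come from
the coproduct of x ⊗ y in the braided tensor square. Then ∑ (x₁y₁) Q(x₂, y₂, z) = (x, y, z)
(`mu_quot`). The coproduct of a left-normed product of primitives is a sum over shuffles (`d_fold`).
Hence for x = R_m and y = R_n of primitives this identity is the recursion that defines P_{m,n}: the
terms with r = m or s = n vanish because Q(1, y, z) = Q(x, 1, z) = 0, and the term r = s = 0 is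
Q(R_m, R_n, z). So P_{m,n} = Q(R_m, R_n, ·) on primitives (`suDiagram_mul`).

It remains to see that Q(R_m, R_n, z) is primitive. Since τ² = 1, the braiding respects the product
of the braided tensor square, so products of primitives are cocommutative: τ fixes their coproduct.
For cocommutative x, y and primitive z, the coproduct of (x, y, z) is ∑ x₁y₁ ⊗ (x₂, y₂, z) plus its
image under τ (`d_assoc_of_prim`). Writing D(u) = Δ(u) - u ⊗ 1 - 1 ⊗ u and expressing associators
through Q gives ∑ Δ(x₁y₁) · D(Q(x₂, y₂, z)) = 0 for x = R_m and y = R_n (`mm_d_prim_quot`). After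
expansion over shuffles, induction on m + n kills every term except D(Q(R_m, R_n, z)), which is
therefore zero (`prim_quot_fold`).

All computations take place in one ring, the operators on a nonzero module W with B ⊗ W ≃ W. A map
between tensor powers of B acts on the first strands of W, so arities never have to be matched, and
tensors in B ⊗ B are recovered because B ⊗ B embeds in End W (`cons₂_injective`). -/

namespace BraidedNA

/-- The ring of strand diagrams of a braided nonassociative Hopf algebra with involutive braiding.
A diagram acts on the strands `0, 1, …` and multiplication is composition (the right factor acts
first); `shift` adds a vertical strand on the left. -/
structure StrandCalculus (R : Type*) [Ring R] where
  shift : R →+* R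
  t : R
  mu : R
  d : R
  eta : R
  eps : R
  q : R
  -- Interchange laws. As `R` does not record arities, the numbers of shifts on the left and on the
  -- right count the strands that the generator consumes and creates.
  t_nat : ∀ f, t * shift (shift f) = shift (shift f) * t
  mu_nat : ∀ f, mu * shift (shift f) = shift f * mu
  q_nat : ∀ f, q * shift (shift f) = shift f * q
  d_nat : ∀ f, d * shift f = shift (shift f) * d
  eta_nat : ∀ f, eta * f = shift f * eta
  eps_nat : ∀ f, eps * shift f = f * eps
  t_t : t * t = 1
  t_mu : t * mu = shift mu * t * shift t
  t_shift_mu : t * shift mu = mu * shift t * t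
  t_eta : t * eta = shift eta
  t_shift_eta : t * shift eta = eta
  eps_t : eps * t = shift eps
  shift_d_t : shift d * t = t * shift t * d
  d_t : d * t = shift t * t * shift d
  d_d : d * d = shift d * d
  eps_d : eps * d = 1
  shift_eps_d : shift eps * d = 1
  mu_eta : mu * eta = 1
  mu_shift_eta : mu * shift eta = 1
  d_eta : d * eta = eta * eta
  d_mu' : d * mu = shift mu * mu * shift t * shift (shift d) * d
  mu_q : mu * shift q * d = eps
  q_mu : q * shift mu * d = eps

/-! ### Rewriting rules for diagrams at an arbitrary position. -/

namespace StrandCalculus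

variable {R : Type*} [Ring R] (S : StrandCalculus R)

/-- The diagram `f` with `i` vertical strands added on the left. -/
def sh (i : ℕ) : R →+* R := S.shift ^ i

theorem sh_sh (i j : ℕ) (f : R) : S.sh i (S.sh j f) = S.sh (i + j) f := by
  simp only [sh, pow_add]; rfl

theorem shift_eq (f : R) : S.shift f = S.sh 1 f := by simp [sh]

theorem shift_sh (i : ℕ) (f : R) : S.shift (S.sh i f) = S.sh (i + 1) f := by
  rw [shift_eq, sh_sh, add_comm]

theorem sh_shift (i : ℕ) (f : R) : S.sh i (S.shift f) = S.sh (i + 1) f := by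
  rw [shift_eq, sh_sh]

/-- Relations are moved to position `i` and followed by an arbitrary tail `x`, so that they rewrite
inside right-nested products. -/
theorem sh_congr {a b : R} (h : a = b) (i : ℕ) (x : R) : S.sh i a * x = S.sh i b * x := by rw [h]

theorem t_far {i j : ℕ} (h : i + 1 < j) (f x : R) :
    S.sh i S.t * (S.sh j f * x) = S.sh j f * (S.sh i S.t * x) := by
  obtain ⟨l, rfl⟩ := Nat.exists_eq_add_of_lt h
  have := S.sh_congr (S.t_nat (S.sh l f)) i x
  simpa only [map_mul, mul_assoc, shift_sh, sh_sh, add_assoc, add_comm, add_left_comm] using this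

theorem mu_far {i j : ℕ} (h : i + 1 < j) (f x : R) :
    S.sh i S.mu * (S.sh j f * x) = S.sh (j - 1) f * (S.sh i S.mu * x) := by
  obtain ⟨l, rfl⟩ := Nat.exists_eq_add_of_lt h
  have := S.sh_congr (S.mu_nat (S.sh l f)) i x
  have e : i + 1 + l + 1 - 1 = i + (l + 1) := by omega
  rw [e]
  simpa only [map_mul, mul_assoc, shift_sh, sh_sh, add_assoc, add_comm, add_left_comm] using this

theorem q_far {i j : ℕ} (h : i + 1 < j) (f x : R) :
    S.sh i S.q * (S.sh j f * x) = S.sh (j - 1) f * (S.sh i S.q * x) := by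
  obtain ⟨l, rfl⟩ := Nat.exists_eq_add_of_lt h
  have := S.sh_congr (S.q_nat (S.sh l f)) i x
  have e : i + 1 + l + 1 - 1 = i + (l + 1) := by omega
  rw [e]
  simpa only [map_mul, mul_assoc, shift_sh, sh_sh, add_assoc, add_comm, add_left_comm] using this

theorem d_far {i j : ℕ} (h : i < j) (f x : R) :
    S.sh i S.d * (S.sh j f * x) = S.sh (j + 1) f * (S.sh i S.d * x) := by
  obtain ⟨l, rfl⟩ := Nat.exists_eq_add_of_lt h
  have := S.sh_congr (S.d_nat (S.sh l f)) i x
  simpa only [map_mul, mul_assoc, shift_sh, sh_sh, add_assoc, add_comm, add_left_comm] using this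

theorem eps_far {i j : ℕ} (h : i < j) (f x : R) :
    S.sh i S.eps * (S.sh j f * x) = S.sh (j - 1) f * (S.sh i S.eps * x) := by
  obtain ⟨l, rfl⟩ := Nat.exists_eq_add_of_lt h
  have := S.sh_congr (S.eps_nat (S.sh l f)) i x
  rw [Nat.add_sub_cancel]
  simpa only [map_mul, mul_assoc, shift_sh, sh_sh, add_assoc, add_comm, add_left_comm] using this

theorem eta_far {i j : ℕ} (h : i ≤ j) (f x : R) :
    S.sh i S.eta * (S.sh j f * x) = S.sh (j + 1) f * (S.sh i S.eta * x) := by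
  obtain ⟨l, rfl⟩ := Nat.exists_eq_add_of_le h
  have := S.sh_congr (S.eta_nat (S.sh l f)) i x
  simpa only [map_mul, mul_assoc, shift_sh, sh_sh, add_assoc, add_comm, add_left_comm] using this

theorem tt (i : ℕ) (x : R) :
    S.sh i S.t * (S.sh i S.t * x) = x := by
  simpa only [map_mul, map_one, one_mul, mul_assoc, sh_shift, add_assoc, Nat.reduceAdd] using
    S.sh_congr S.t_t i x

theorem t_mu0 (i : ℕ) (x : R) :
    S.sh i S.t * (S.sh i S.mu * x) = S.sh (i + 1) S.mu * (S.sh i S.t * (S.sh (i + 1) S.t * x)) := by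
  simpa only [map_mul, map_one, one_mul, mul_assoc, sh_shift, add_assoc, Nat.reduceAdd] using
    S.sh_congr S.t_mu i x

theorem t_mu1 (i : ℕ) (x : R) :
    S.sh i S.t * (S.sh (i + 1) S.mu * x) = S.sh i S.mu * (S.sh (i + 1) S.t * (S.sh i S.t * x)) := by
  simpa only [map_mul, map_one, one_mul, mul_assoc, sh_shift, add_assoc, Nat.reduceAdd] using
    S.sh_congr S.t_shift_mu i x

theorem t_eta0 (i : ℕ) (x : R) :
    S.sh i S.t * (S.sh i S.eta * x) = S.sh (i + 1) S.eta * x := by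
  simpa only [map_mul, map_one, one_mul, mul_assoc, sh_shift, add_assoc, Nat.reduceAdd] using
    S.sh_congr S.t_eta i x

theorem t_eta1 (i : ℕ) (x : R) :
    S.sh i S.t * (S.sh (i + 1) S.eta * x) = S.sh i S.eta * x := by
  simpa only [map_mul, map_one, one_mul, mul_assoc, sh_shift, add_assoc, Nat.reduceAdd] using
    S.sh_congr S.t_shift_eta i x

theorem eps0_t (i : ℕ) (x : R) :
    S.sh i S.eps * (S.sh i S.t * x) = S.sh (i + 1) S.eps * x := by
  simpa only [map_mul, map_one, one_mul, mul_assoc, sh_shift, add_assoc, Nat.reduceAdd] using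
    S.sh_congr S.eps_t i x

theorem d1_t (i : ℕ) (x : R) :
    S.sh (i + 1) S.d * (S.sh i S.t * x) = S.sh i S.t * (S.sh (i + 1) S.t * (S.sh i S.d * x)) := by
  simpa only [map_mul, map_one, one_mul, mul_assoc, sh_shift, add_assoc, Nat.reduceAdd] using
    S.sh_congr S.shift_d_t i x

theorem d0_t (i : ℕ) (x : R) :
    S.sh i S.d * (S.sh i S.t * x) = S.sh (i + 1) S.t * (S.sh i S.t * (S.sh (i + 1) S.d * x)) := by
  simpa only [map_mul, map_one, one_mul, mul_assoc, sh_shift, add_assoc, Nat.reduceAdd] using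
    S.sh_congr S.d_t i x

theorem d0_d (i : ℕ) (x : R) :
    S.sh i S.d * (S.sh i S.d * x) = S.sh (i + 1) S.d * (S.sh i S.d * x) := by
  simpa only [map_mul, map_one, one_mul, mul_assoc, sh_shift, add_assoc, Nat.reduceAdd] using
    S.sh_congr S.d_d i x

theorem eps0_d (i : ℕ) (x : R) :
    S.sh i S.eps * (S.sh i S.d * x) = x := by
  simpa only [map_mul, map_one, one_mul, mul_assoc, sh_shift, add_assoc, Nat.reduceAdd] using
    S.sh_congr S.eps_d i x

theorem eps1_d (i : ℕ) (x : R) :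
    S.sh (i + 1) S.eps * (S.sh i S.d * x) = x := by
  simpa only [map_mul, map_one, one_mul, mul_assoc, sh_shift, add_assoc, Nat.reduceAdd] using
    S.sh_congr S.shift_eps_d i x

theorem mu_eta0 (i : ℕ) (x : R) :
    S.sh i S.mu * (S.sh i S.eta * x) = x := by
  simpa only [map_mul, map_one, one_mul, mul_assoc, sh_shift, add_assoc, Nat.reduceAdd] using
    S.sh_congr S.mu_eta i x

theorem mu_eta1 (i : ℕ) (x : R) :
    S.sh i S.mu * (S.sh (i + 1) S.eta * x) = x := by
  simpa only [map_mul, map_one, one_mul, mul_assoc, sh_shift, add_assoc, Nat.reduceAdd] using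
    S.sh_congr S.mu_shift_eta i x

theorem d_eta0 (i : ℕ) (x : R) :
    S.sh i S.d * (S.sh i S.eta * x) = S.sh i S.eta * (S.sh i S.eta * x) := by
  simpa only [map_mul, map_one, one_mul, mul_assoc, sh_shift, add_assoc, Nat.reduceAdd] using
    S.sh_congr S.d_eta i x

theorem d_mu0 (i : ℕ) (x : R) :
    S.sh i S.d * (S.sh i S.mu * x) = S.sh (i + 1) S.mu *
      (S.sh i S.mu * (S.sh (i + 1) S.t * (S.sh (i + 2) S.d * (S.sh i S.d * x)))) := by
  simpa only [map_mul, map_one, one_mul, mul_assoc, sh_shift, add_assoc, Nat.reduceAdd] using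
    S.sh_congr S.d_mu' i x

theorem mu_q1_d (i : ℕ) (x : R) :
    S.sh i S.mu * (S.sh (i + 1) S.q * (S.sh i S.d * x)) = S.sh i S.eps * x := by
  simpa only [map_mul, map_one, one_mul, mul_assoc, sh_shift, add_assoc, Nat.reduceAdd] using
    S.sh_congr S.mu_q i x

theorem q_mu1_d (i : ℕ) (x : R) :
    S.sh i S.q * (S.sh (i + 1) S.mu * (S.sh i S.d * x)) = S.sh i S.eps * x := by
  simpa only [map_mul, map_one, one_mul, mul_assoc, sh_shift, add_assoc, Nat.reduceAdd] using
    S.sh_congr S.q_mu i x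

/-! ### The braided tensor square and the convolution quotient of the associator. -/

/-- The braided coproduct of two adjacent strands. -/
def dd : R := S.sh 1 S.t * S.sh 2 S.d * S.sh 0 S.d

/-- The braided product of two adjacent pairs of strands. -/
def mm : R := S.sh 1 S.mu * S.sh 0 S.mu * S.sh 1 S.t

/-- The associator. -/
def assoc : R := S.sh 0 S.mu * (S.sh 0 S.mu - S.sh 1 S.mu)

/-- The convolution quotient of the associator by the product of its first two arguments. -/
def quot : R := S.sh 0 S.q * S.sh 1 S.assoc * S.sh 0 S.mu * S.dd

/-- The primitivity defect of a strand. -/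
def prim : R := S.sh 0 S.d - S.sh 0 S.eta - S.sh 1 S.eta

theorem dd_far {i j : ℕ} (h : i + 1 < j) (f x : R) :
    S.sh i S.dd * (S.sh j f * x) = S.sh (j + 2) f * (S.sh i S.dd * x) := by
  simp (disch := omega) only [dd, map_mul, sh_sh, mul_assoc, d_far, t_far, add_zero]

theorem mm_far {i j : ℕ} (h : i + 3 < j) (f x : R) :
    S.sh i S.mm * (S.sh j f * x) = S.sh (j - 2) f * (S.sh i S.mm * x) := by
  simp (disch := omega) only [mm, map_mul, sh_sh, mul_assoc, mu_far, t_far, add_zero,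
    Nat.sub_sub]

theorem assoc_far {i j : ℕ} (h : i + 2 < j) (f x : R) :
    S.sh i S.assoc * (S.sh j f * x) = S.sh (j - 2) f * (S.sh i S.assoc * x) := by
  simp (disch := omega) only [assoc, map_mul, map_sub, sub_mul, mul_sub, sh_sh, mul_assoc, mu_far,
    add_zero, Nat.sub_sub]

theorem prim_far {i j : ℕ} (h : i < j) (f x : R) :
    S.sh i S.prim * (S.sh j f * x) = S.sh (j + 1) f * (S.sh i S.prim * x) := by
  simp (disch := omega) only [prim, map_sub, sub_mul, mul_sub, sh_sh, d_far, eta_far, add_zero]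

theorem d_mu (i : ℕ) (x : R) : S.sh i S.d * (S.sh i S.mu * x) =
    S.sh (i + 1) S.mu * (S.sh i S.mu * (S.sh i S.dd * x)) := by
  simp only [d_mu0, dd, map_mul, sh_sh, mul_assoc, add_zero]

theorem d_mu_mm (i : ℕ) (x : R) : S.sh i S.d * (S.sh i S.mu * x) =
    S.sh i S.mm * (S.sh (i + 2) S.d * (S.sh i S.d * x)) := by
  simp only [d_mu0, mm, map_mul, sh_sh, mul_assoc, add_zero]

/-- Coassociativity of the braided tensor square, from coassociativity of Δ and its compatibility
with τ. -/
theorem dd_dd (x : R) :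
    S.sh 0 S.dd * (S.sh 0 S.dd * x) = S.sh 2 S.dd * (S.sh 0 S.dd * x) := by
  simp only [dd, map_mul, sh_sh, mul_assoc, Nat.reduceAdd]
  rw [S.d_far (i := 0) (j := 1) (by omega), S.d0_t 2, S.d1_t 1]
  simp (disch := omega) only [d_far, Nat.reduceAdd]
  rw [S.d0_d 0]
  simp (disch := omega) only [← S.t_far (j := 4), Nat.reduceAdd]
  rw [← S.d0_d 3, S.t_far (i := 1) (j := 3) (by omega)]

/-- The braiding is multiplicative on the braided tensor square. Involutivity is essential: moving
both products across the crossing leaves a double crossing of the middle strands, which `tt`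
removes. -/
theorem t_mm (i : ℕ) (x : R) : S.sh i S.t * (S.sh i S.mm * x) =
    S.sh i S.mm * (S.sh i S.t * (S.sh (i + 2) S.t * x)) := by
  simp only [mm, map_mul, sh_sh, mul_assoc, add_zero]
  rw [S.t_mu1, S.t_mu0, S.t_mu0 (i + 1), S.tt]
  simp (disch := omega) only [mu_far, t_far, add_tsub_cancel_right]

theorem mu_dd_counit (i : ℕ) (x : R) :
    S.sh i S.mu * (S.sh (i + 2) S.eps * (S.sh (i + 2) S.mu * (S.sh i S.dd * x))) =
      S.sh i S.mu * x := by
  simp (disch := omega) only [mu_far, Nat.reduceSubDiff]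
  rw [← S.d_mu, S.eps1_d]

/-- Multiplicativity of Δ and the counit give ∑ (x₁y₁) ε(x₂y₂) = xy. The left factor can be stripped
off because x ⊗ y ↦ ∑ x₁ ⊗ x₂y has a left inverse. -/
theorem counit_mul_dd (x : R) : S.sh 2 S.eps * (S.sh 2 S.mu * (S.sh 0 S.dd * x)) = x := by
  -- The left inverse is x ⊗ y ↦ ∑ x₁ ⊗ x₂ \ y.
  have key (y : R) : S.sh 1 S.q * (S.sh 0 S.d * (S.sh 1 S.mu * (S.sh 0 S.d * y))) = y := by
    simp (disch := omega) only [d_far, d0_d, Nat.reduceAdd]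
    rw [S.q_mu1_d 1, S.eps1_d 0]
  have h : S.sh 0 S.d * (S.sh 0 S.dd * x) = S.sh 1 S.dd * (S.sh 0 S.d * x) := by
    simp (disch := omega) only [dd, map_mul, sh_sh, mul_assoc, d_far, Nat.reduceAdd]
    rw [S.d0_d 0]
  rw [← key (S.sh 2 S.eps * _)]
  simp (disch := omega) only [d_far _ (j := 2), h, Nat.reduceAdd]
  rw [S.mu_dd_counit 1, key]

theorem eps_eps_dd (x : R) : S.sh 0 S.eps * (S.sh 0 S.eps * (S.sh 0 S.dd * x)) = x := by
  simp (disch := omega) only [dd, map_mul, sh_sh, mul_assoc, eps_far, Nat.reduceAdd, Nat.reduceSub]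
  rw [S.eps0_t 0]
  simp (disch := omega) only [eps0_d, Nat.reduceAdd]

/-- Multiplicativity of the counit is not an axiom; it follows by applying ε ⊗ ε to `counit_mul_dd`.
-/
theorem eps_mu (x : R) :
    S.sh 0 S.eps * (S.sh 0 S.mu * x) = S.sh 0 S.eps * (S.sh 0 S.eps * x) := by
  conv_rhs => rw [← S.counit_mul_dd x]
  simp (disch := omega) only [eps_far, eps_eps_dd, Nat.reduceSub]

/-- Multiplicativity of Δ together with `dd_dd`: both sides are ∑ x₁y₁ ⊗ x₂y₂ ⊗ x₃ ⊗ y₃. -/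
theorem mu_dd_mu_dd_zero (x : R) :
    S.sh 1 S.mu * (S.sh 1 S.dd * (S.sh 0 S.mu * (S.sh 0 S.dd * x))) =
     S.sh 0 S.d * (S.sh 0 S.mu * (S.sh 0 S.dd * x)) := by
  rw [S.d_mu 0, S.dd_dd]
  simp (disch := omega) only [mu_far, dd, map_mul, sh_sh, mul_assoc, Nat.reduceAdd, Nat.reduceSub]

theorem mu_dd_mu_dd (i : ℕ) (x : R) : 
    S.sh (i + 1) S.mu * (S.sh (i + 1) S.dd * (S.sh i S.mu * (S.sh i S.dd * x))) =
      S.sh i S.d * (S.sh i S.mu * (S.sh i S.dd * x)) := by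
  -- Position 0 suffices: take the tail 1 there, apply the ring homomorphism `sh i`, and multiply by
  -- `x`.
  simpa only [map_mul, map_sub, map_one, map_zero, zero_mul, mul_one, mul_assoc, sh_sh, add_zero]
    using congrArg (fun y => S.sh i y * x) (S.mu_dd_mu_dd_zero 1)

/-- The defining property of the quotient. Unfolded, the left side is ∑ (x₁y₁)((x₂y₂) \ (x₃, y₃,
z)); division cancels to ε(x₁y₁), which the multiplicative counit absorbs. -/
theorem mu_quot_zero (x : R) :
    S.sh 0 S.mu * (S.sh 1 S.quot * (S.sh 0 S.mu * (S.sh 0 S.dd * x))) = S.sh 0 S.assoc * x := by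
  trans S.sh 0 S.eps * (S.sh 1 S.assoc * (S.sh 0 S.mu * (S.sh 0 S.dd * x)))
  · rw [← S.mu_q1_d, S.d_far (by omega)]
    simp only [quot, map_mul, sh_sh, mul_assoc, Nat.reduceAdd, mu_dd_mu_dd_zero]
  · rw [S.eps_far (by omega), S.eps_mu, S.eps_eps_dd]

theorem mu_quot (i : ℕ) (x : R) : 
    S.sh i S.mu * (S.sh (i + 1) S.quot * (S.sh i S.mu * (S.sh i S.dd * x))) = S.sh i S.assoc * x := by
  simpa only [map_mul, map_sub, map_one, map_zero, zero_mul, mul_one, mul_assoc, sh_sh, add_zero]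
    using congrArg (fun y => S.sh i y * x) (S.mu_quot_zero 1)

theorem dd_eta0 (x : R) : S.sh 0 S.dd * (S.sh 0 S.eta * x) =
    S.sh 0 S.eta * (S.sh 1 S.eta * (S.sh 0 S.d * x)) := by
  simp (disch := omega) only [dd, map_mul, sh_sh, mul_assoc, d_eta0, eta_far, Nat.reduceAdd]
  rw [← S.t_eta0 1, S.eta_far (j := 1) (by omega)]

theorem dd_eta1 (x : R) : S.sh 0 S.dd * (S.sh 1 S.eta * x) =
    S.sh 1 S.eta * (S.sh 2 S.eta * (S.sh 0 S.d * x)) := by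
  simp (disch := omega) only [dd, map_mul, sh_sh, mul_assoc, d_eta0, d_far, Nat.reduceAdd]
  rw [S.t_eta1 1]

theorem assoc_eta0 (i : ℕ) (x : R) : S.sh i S.assoc * (S.sh i S.eta * x) = 0 := by
  simp only [assoc, map_mul, map_sub, sub_mul, mul_sub, sh_sh, mul_assoc, add_zero, mu_eta0]
  rw [← S.eta_far le_rfl, mu_eta0, sub_self]

theorem assoc_eta1 (i : ℕ) (x : R) : S.sh i S.assoc * (S.sh (i + 1) S.eta * x) = 0 := by
  simp only [assoc, map_mul, map_sub, sub_mul, mul_sub, sh_sh, mul_assoc, add_zero, mu_eta0,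
    mu_eta1, sub_self]

/-- Since Δ(1) = 1 ⊗ 1, the associator inside the quotient also receives the argument 1, and
vanishes. -/
theorem quot_eta0_zero (x : R) : S.sh 0 S.quot * (S.sh 0 S.eta * x) = 0 := by
  simp only [quot, map_mul, sh_sh, mul_assoc, dd_eta0, mu_eta0, Nat.reduceAdd, assoc_eta0, mul_zero]

theorem quot_eta0 (i : ℕ) (x : R) : S.sh i S.quot * (S.sh i S.eta * x) = 0 := by
  simpa only [map_mul, map_sub, map_one, map_zero, zero_mul, mul_one, mul_assoc, sh_sh, add_zero]
    using congrArg (fun y => S.sh i y * x) (S.quot_eta0_zero 1)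

theorem quot_eta1_zero (x : R) : S.sh 0 S.quot * (S.sh 1 S.eta * x) = 0 := by
  simp only [quot, map_mul, sh_sh, mul_assoc, dd_eta1, Nat.reduceAdd]
  rw [S.mu_eta1 0, S.assoc_eta1 1, mul_zero]

theorem quot_eta1 (i : ℕ) (x : R) : S.sh i S.quot * (S.sh (i + 1) S.eta * x) = 0 := by
  simpa only [map_mul, map_sub, map_one, map_zero, zero_mul, mul_one, mul_assoc, sh_sh, add_zero]
    using congrArg (fun y => S.sh i y * x) (S.quot_eta1_zero 1)

theorem mm_eta2 (i : ℕ) (x : R) : S.sh i S.mm * (S.sh (i + 2) S.eta * x) = S.sh (i + 1) S.mu * x := by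
  simp only [mm, map_mul, sh_sh, mul_assoc, add_zero]
  rw [S.t_eta1 (i + 1), S.mu_eta1]

theorem mm_eta3 (i : ℕ) (x : R) : S.sh i S.mm * (S.sh (i + 3) S.eta * x) =
    S.sh i S.mu * (S.sh (i + 1) S.t * x) := by
  simp only [mm, map_mul, sh_sh, mul_assoc, add_zero]
  rw [S.t_far (by omega), S.mu_far (i := i) (j := i + 3) (by omega)]
  exact S.mu_eta1 (i + 1) _

/-- As Δ is multiplicative, it sends an associator to the associator of the coproducts in the
braided tensor square. -/
theorem d_assoc_zero (x : R) : S.sh 0 S.d * (S.sh 0 S.assoc * x) =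
    S.sh 0 S.mm * ((S.sh 0 S.mm - S.sh 2 S.mm) *
      (S.sh 2 S.d * (S.sh 0 S.d * (S.sh 2 S.d * x)))) := by
  simp only [assoc, map_mul, map_sub, sub_mul, mul_sub, sh_sh, mul_assoc, add_zero]
  simp (disch := omega) only [d_mu_mm, mm_far, d_far, Nat.reduceAdd, Nat.reduceSub]

theorem d_assoc (i : ℕ) (x : R) : S.sh i S.d * (S.sh i S.assoc * x) =
    S.sh i S.mm * ((S.sh i S.mm - S.sh (i + 2) S.mm) *
      (S.sh (i + 2) S.d * (S.sh i S.d * (S.sh (i + 2) S.d * x)))) := by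
  simpa only [map_mul, map_sub, map_one, map_zero, zero_mul, mul_one, mul_assoc, sh_sh, add_zero]
    using congrArg (fun y => S.sh i y * x) (S.d_assoc_zero 1)

theorem t_mm_mm_zero (x : R) :
    S.sh 0 S.t * (S.sh 0 S.mm * ((S.sh 0 S.mm - S.sh 2 S.mm) * x)) =
    S.sh 0 S.mm * ((S.sh 0 S.mm - S.sh 2 S.mm) *
      (S.sh 0 S.t * (S.sh 2 S.t * (S.sh 4 S.t * x)))) := by
  have h (y : R) : S.sh 2 S.t * (S.sh 0 S.mm * y) = S.sh 0 S.mm * (S.sh 4 S.t * y) :=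
    (S.mm_far (j := 4) (by omega) _ _).symm
  simp only [sub_mul, mul_sub, t_mm, Nat.reduceAdd, h]
  simp (disch := omega) only [S.t_far (i := 0) (j := 2)]

theorem t_mm_mm (i : ℕ) (x : R) : 
    S.sh i S.t * (S.sh i S.mm * ((S.sh i S.mm - S.sh (i + 2) S.mm) * x)) =
    S.sh i S.mm * ((S.sh i S.mm - S.sh (i + 2) S.mm) *
      (S.sh i S.t * (S.sh (i + 2) S.t * (S.sh (i + 4) S.t * x)))) := by
  simpa only [map_mul, map_sub, map_one, map_zero, zero_mul, mul_one, mul_assoc, sh_sh, add_zero]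
    using congrArg (fun y => S.sh i y * x) (S.t_mm_mm_zero 1)

/-- The associator of Δ(x), Δ(y) and 1 ⊗ z in the braided tensor square: the first components see
only the factor 1, so just the second components are associated. -/
theorem mm_mm_eta_zero (x : R) :
    S.sh 0 S.mm * ((S.sh 0 S.mm - S.sh 2 S.mm) *
      (S.sh 4 S.eta * (S.sh 2 S.d * (S.sh 0 S.d * x)))) =
    S.sh 1 S.assoc * (S.sh 0 S.mu * (S.sh 0 S.dd * x)) := by
  simp only [sub_mul, mul_sub]
  rw [S.mm_far (i := 0) (j := 4) (by omega), S.mm_eta2 2, S.mm_eta2 0]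
  simp (disch := omega) only [mm, dd, assoc, map_mul, map_sub, sub_mul, mul_sub, sh_sh, mul_assoc,
    t_far, mu_far, Nat.reduceAdd, Nat.reduceSub]

theorem mm_mm_eta (i : ℕ) (x : R) : 
    S.sh i S.mm * ((S.sh i S.mm - S.sh (i + 2) S.mm) *
      (S.sh (i + 4) S.eta * (S.sh (i + 2) S.d * (S.sh i S.d * x)))) =
    S.sh (i + 1) S.assoc * (S.sh i S.mu * (S.sh i S.dd * x)) := by
  simpa only [map_mul, map_sub, map_one, map_zero, zero_mul, mul_one, mul_assoc, sh_sh, add_zero]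
    using congrArg (fun y => S.sh i y * x) (S.mm_mm_eta_zero 1)

variable {S} in
theorem d_of_prim {i : ℕ} {f : R} (h : S.sh i S.prim * f = 0) :
    S.sh i S.d * f = S.sh i S.eta * f + S.sh (i + 1) S.eta * f := by
  simp only [prim, map_sub, sub_mul, sh_sh, add_zero] at h
  rw [← sub_eq_zero, ← h]; abel

/-- The coproduct of an associator whose first two arguments are cocommutative and whose third
argument is primitive. -/
theorem d_assoc_of_prim {i : ℕ} {f : R}
    (h0 : S.sh i S.t * (S.sh i S.d * f) = S.sh i S.d * f)
    (h1 : S.sh (i + 1) S.t * (S.sh (i + 1) S.d * f) = S.sh (i + 1) S.d * f) (h2 : S.sh (i + 2) S.prim * f = 0) :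
    S.sh i S.d * (S.sh i S.assoc * f) =
      S.sh (i + 1) S.assoc * (S.sh i S.mu * (S.sh i S.dd * f)) +
      S.sh i S.t * (S.sh (i + 1) S.assoc * (S.sh i S.mu * (S.sh i S.dd * f))) := by
  have h3 := d_of_prim h2
  have h4 : S.sh i S.t * (S.sh (i + 2) S.t * (S.sh (i + 2) S.d * (S.sh i S.d * f))) =
      S.sh (i + 2) S.d * (S.sh i S.d * f) := by
    have e (g y : R) : S.sh (i + 2) g * (S.sh i S.d * y) = S.sh i S.d * (S.sh (i + 1) g * y) :=
      (S.d_far (j := i + 1) (by omega) _ _).symm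
    rw [e, e, h1, ← e, S.t_far (by omega), h0]
  -- Here Δ(z) = 1 ⊗ z + z ⊗ 1 and z ⊗ 1 = τ(1 ⊗ z). As τ also fixes Δ(x) and Δ(y), the second
  -- summand is the image of the first under τ.
  rw [d_assoc, h3, ← mm_mm_eta, t_mm_mm, S.t_eta0 (i + 4)]
  simp (disch := omega) only [mul_add, t_far _ (j := i + 4 + 1), d_far _ (f := S.eta), h4, add_assoc,
    Nat.reduceAdd]

/-- The product of two cocommutative strands is cocommutative. -/
theorem t_d_mu {i : ℕ} {f : R} (h0 : S.sh i S.t * (S.sh i S.d * f) = S.sh i S.d * f)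
    (h1 : S.sh (i + 1) S.t * (S.sh (i + 1) S.d * f) = S.sh (i + 1) S.d * f) :
    S.sh i S.t * (S.sh i S.d * (S.sh i S.mu * f)) = S.sh i S.d * (S.sh i S.mu * f) := by
  have e (g y : R) : S.sh (i + 2) g * (S.sh i S.d * y) = S.sh i S.d * (S.sh (i + 1) g * y) :=
    (S.d_far (j := i + 1) (by omega) _ _).symm
  rw [d_mu_mm, t_mm, e, e, h1, ← e, S.t_far (by omega), h0]

end StrandCalculus

end BraidedNA

namespace BraidedNA

/-! ### Sums over shuffles -/

/-- The permutation of `Fin (m + 1)` that sends `p` to the last element and agrees with `π` up to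
the order isomorphisms between the complements. -/
def insertLast {m : ℕ} (p : Fin (m + 1)) (π : Equiv.Perm (Fin m)) : Equiv.Perm (Fin (m + 1)) :=
  ((finSuccEquiv' p).trans (Equiv.optionCongr π)).trans (finSuccEquiv' (Fin.last m)).symm

@[simp]
theorem insertLast_self {m : ℕ} (p : Fin (m + 1)) (π : Equiv.Perm (Fin m)) :
    insertLast p π p = Fin.last m := by
  simp [insertLast]

@[simp]
theorem insertLast_succAbove {m : ℕ} (p : Fin (m + 1)) (π : Equiv.Perm (Fin m)) (i : Fin m) :
    insertLast p π (p.succAbove i) = (π i).castSucc := by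
  simp [insertLast]

theorem insertLast_injective {m : ℕ} (p : Fin (m + 1)) : Function.Injective (insertLast p) := by
  intro π σ h
  ext i
  have := congrArg (fun e => e (p.succAbove i)) h
  simpa using congrArg Fin.val this

theorem exists_insertLast {m : ℕ} (p : Fin (m + 1)) (ρ : Equiv.Perm (Fin (m + 1)))
    (h : ρ p = Fin.last m) : ∃ π, insertLast p π = ρ := by
  let σ : Equiv.Perm (Option (Fin m)) :=
    ((finSuccEquiv' p).symm.trans ρ).trans (finSuccEquiv' (Fin.last m))
  have hσ : σ none = none := by simp [σ, h]
  refine ⟨Equiv.removeNone σ, ?_⟩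
  rw [insertLast, map_equiv_removeNone, hσ, Equiv.swap_self]
  ext i
  simp [σ]

theorem mem_shuffles {r n : ℕ} {π : Equiv.Perm (Fin n)} : π ∈ shuffles r n ↔
    (∀ i j : Fin n, i < j → j.val < r → π i < π j) ∧
      (∀ i j : Fin n, r ≤ i.val → i < j → π i < π j) := by
  simp [shuffles]

theorem insertLast_last_castSucc {m : ℕ} (π : Equiv.Perm (Fin m)) (i : Fin m) :
    insertLast (Fin.last m) π i.castSucc = (π i).castSucc := by
  rw [← Fin.succAbove_last_apply, insertLast_succAbove]

theorem insertLast_mem_shuffles {m r : ℕ} (π : Equiv.Perm (Fin m)) :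
    insertLast (Fin.last m) π ∈ shuffles r (m + 1) ↔ π ∈ shuffles r m := by
  have h1 (i : Fin m) : ¬ Fin.last m < i.castSucc := not_lt.2 (Fin.le_last _)
  simp [mem_shuffles, Fin.forall_fin_succ', insertLast_last_castSucc, h1, Fin.castSucc_lt_last]

theorem val_succAbove_lt {m r : ℕ} (h : r < m + 1) (i : Fin m) :
    ((⟨r, h⟩ : Fin (m + 1)).succAbove i).val < r + 1 ↔ i.val < r := by
  rw [Fin.succAbove]
  split_ifs with h1 <;> simp [Fin.lt_def] at h1 ⊢; all_goals omega

theorem insertLast_mem_shuffles_succ {m r : ℕ} (h : r < m + 1) (π : Equiv.Perm (Fin m)) :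
    insertLast ⟨r, h⟩ π ∈ shuffles (r + 1) (m + 1) ↔ π ∈ shuffles r m := by
  have h1 (i : Fin m) : ¬ Fin.last m < i.castSucc := not_lt.2 (Fin.le_last _)
  have h2 (i : Fin m) : r + 1 ≤ ((⟨r, h⟩ : Fin (m + 1)).succAbove i).val ↔ r ≤ i.val := by
    rw [← not_lt, val_succAbove_lt, not_lt]
  have h3 (i : Fin m) : (⟨r, h⟩ : Fin (m + 1)) < (⟨r, h⟩ : Fin (m + 1)).succAbove i ↔ r ≤ i.val := by
    rw [← h2 i, Fin.lt_def]; rfl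
  simp only [mem_shuffles, Fin.forall_iff_succAbove (⟨r, h⟩ : Fin (m + 1)), insertLast_self,
    insertLast_succAbove, h1, h2, h3, Fin.castSucc_lt_last, val_succAbove_lt,
    Fin.succAbove_lt_succAbove_iff, Fin.castSucc_lt_castSucc_iff, lt_irrefl]
  simp

/-- A shuffle increases on each of its two blocks, so its largest value is attained at the end of a
block. -/
theorem shuffle_eq_last {m r : ℕ} (hrm : r ≤ m + 1) {ρ : Equiv.Perm (Fin (m + 1))}
    (h : ρ ∈ shuffles r (m + 1)) :
    (ρ (Fin.last m) = Fin.last m ∧ r ≤ m) ∨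
      ∃ h : r - 1 < m + 1, 0 < r ∧ ρ ⟨r - 1, h⟩ = Fin.last m := by
  rw [mem_shuffles] at h
  obtain ⟨i, hi⟩ := ρ.surjective (Fin.last m)
  have hmax (j : Fin (m + 1)) : ¬ ρ i < ρ j := by rw [hi]; exact not_lt.2 (Fin.le_last _)
  by_cases hir : i.val < r
  · right
    refine ⟨by omega, by omega, ?_⟩
    rw [← hi]
    refine congrArg ρ ?_
    by_contra hne
    rw [Fin.ext_iff] at hne
    simp only at hne
    exact hmax ⟨r - 1, by omega⟩ (h.1 _ _ (by rw [Fin.lt_def]; simp only; omega)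
      (by simp only; omega))
  · left
    refine ⟨?_, by have := i.2; omega⟩
    refine Eq.trans (congrArg ρ ?_) hi
    by_contra hne
    exact hmax _ (h.2 _ _ (by omega) (lt_of_le_of_ne (Fin.le_last _) (Ne.symm hne)))

theorem shuffleWord_eq {r n : ℕ} (h : r ≤ n) (π : Equiv.Perm (Fin n)) :
    shuffleWord r π = (List.finRange r).flatMap fun i =>
      seg (i.val + 1) ((π (Fin.castLE h i)).val + 1) := by
  have : (List.finRange n).take r = (List.finRange r).map (Fin.castLE h) := by
    apply List.ext_getElem
    · simp [h]
    · intro i h1 h2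
      simp
  rw [shuffleWord, this, List.flatMap_map]
  rfl

theorem shuffleWord_insertLast {m r : ℕ} (h : r ≤ m) (π : Equiv.Perm (Fin m)) :
    shuffleWord r (insertLast (Fin.last m) π) = shuffleWord r π := by
  rw [shuffleWord_eq (h.trans m.le_succ), shuffleWord_eq h]
  congr 1
  ext1 i
  have := insertLast_last_castSucc π (Fin.castLE h i)
  rw [show Fin.castLE (h.trans m.le_succ) i = (Fin.castLE h i).castSucc from rfl, this]
  rfl

theorem shuffleWord_insertLast_succ {m r : ℕ} (h : r < m + 1) (π : Equiv.Perm (Fin m)) :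
    shuffleWord (r + 1) (insertLast ⟨r, h⟩ π) =
      shuffleWord r π ++ seg (r + 1) (m + 1) := by
  rw [shuffleWord_eq (by omega), shuffleWord_eq (Nat.lt_succ_iff.1 h), List.finRange_succ_last,
    List.flatMap_append, List.flatMap_map]
  congr 1
  · congr 1
    ext1 i
    have h1 : Fin.castLE (show r + 1 ≤ m + 1 by omega) i.castSucc =
        (⟨r, h⟩ : Fin (m + 1)).succAbove (Fin.castLE (Nat.lt_succ_iff.1 h) i) := by
      rw [Fin.succAbove_of_castSucc_lt _ _ (by rw [Fin.lt_def]; exact i.2)]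
      rfl
    rw [h1, insertLast_succAbove]
    rfl
  · simp only [List.flatMap_singleton]
    have h1 : Fin.castLE (show r + 1 ≤ m + 1 by omega) (Fin.last r) = ⟨r, h⟩ := rfl
    rw [h1, insertLast_self]
    rfl

/-- Shuffles are sorted by the block containing the preimage of the largest value. Deleting this
preimage leaves a shuffle of `m` symbols. The word is unchanged for the second block and loses its
last segment for the first. -/
theorem sum_shuffles_succ {M : Type*} [AddCommMonoid M] (m : ℕ) (G : ℕ → List ℕ → M) :
    ∑ r ∈ Finset.range (m + 2), ∑ π ∈ shuffles r (m + 1), G r (shuffleWord r π) =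
      ∑ r ∈ Finset.range (m + 1), ∑ π ∈ shuffles r m,
        (G r (shuffleWord r π) + G (r + 1) (shuffleWord r π ++ seg (r + 1) (m + 1))) := by
  -- The condition `r ≤ m` matters at `r = m + 1`: the second block is then empty, and the last
  -- position belongs to the first block.
  let P (r : ℕ) (ρ : Equiv.Perm (Fin (m + 1))) : Prop := ρ (Fin.last m) = Fin.last m ∧ r ≤ m
  have h0 (r : ℕ) (hr : r ∈ Finset.range (m + 1)) :
      ∑ π ∈ shuffles r m, G r (shuffleWord r π) =
        ∑ ρ ∈ (shuffles r (m + 1)).filter (P r), G r (shuffleWord r ρ) := by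
    have hr' : r ≤ m := by simpa [Nat.lt_succ_iff] using hr
    refine Finset.sum_bij (fun π _ => insertLast (Fin.last m) π) ?_ ?_ ?_ ?_
    · intro π hπ
      simp [insertLast_mem_shuffles, hπ, P, hr']
    · intro π _ σ _ h
      exact insertLast_injective _ h
    · intro ρ hρ
      rw [Finset.mem_filter] at hρ
      obtain ⟨π, rfl⟩ := exists_insertLast _ ρ hρ.2.1
      exact ⟨π, (insertLast_mem_shuffles π).1 hρ.1, rfl⟩
    · intro π _
      rw [shuffleWord_insertLast hr']
  have h1 (r : ℕ) (hr : r ∈ Finset.range (m + 1)) :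
      ∑ π ∈ shuffles r m, G (r + 1) (shuffleWord r π ++ seg (r + 1) (m + 1)) =
        ∑ ρ ∈ (shuffles (r + 1) (m + 1)).filter (fun ρ => ¬ P (r + 1) ρ),
          G (r + 1) (shuffleWord (r + 1) ρ) := by
    have hr' : r < m + 1 := by simpa using hr
    refine Finset.sum_bij (fun π _ => insertLast ⟨r, hr'⟩ π) ?_ ?_ ?_ ?_
    · intro π hπ
      rw [Finset.mem_filter]
      refine ⟨(insertLast_mem_shuffles_succ hr' π).2 hπ, ?_⟩
      rintro ⟨h, hm⟩
      have := (insertLast ⟨r, hr'⟩ π).injective (h.trans (insertLast_self ⟨r, hr'⟩ π).symm)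
      rw [Fin.ext_iff] at this
      simp at this
      omega
    · intro π _ σ _ h
      exact insertLast_injective _ h
    · intro ρ hρ
      rw [Finset.mem_filter] at hρ
      obtain h | ⟨_, _, h⟩ := shuffle_eq_last (by omega) hρ.1
      · exact absurd h hρ.2
      · obtain ⟨π, rfl⟩ := exists_insertLast _ ρ h
        exact ⟨π, (insertLast_mem_shuffles_succ hr' π).1 hρ.1, rfl⟩
    · intro π _
      rw [shuffleWord_insertLast_succ hr']
  have h2 : (shuffles (m + 1) (m + 1)).filter (P (m + 1)) = ∅ := by
    simp [P]
  have h3 : (shuffles 0 (m + 1)).filter (fun ρ => ¬ P 0 ρ) = ∅ := by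
    rw [Finset.filter_eq_empty_iff]
    intro ρ hρ
    obtain h | ⟨_, h, _⟩ := shuffle_eq_last (by omega) hρ
    · exact not_not.2 h
    · exact absurd h (lt_irrefl 0)
  simp only [Finset.sum_add_distrib]
  rw [Finset.sum_congr rfl h0, Finset.sum_congr rfl h1]
  conv_lhs =>
    enter [2, r]
    rw [← Finset.sum_filter_add_sum_filter_not _ (P r)]
  rw [Finset.sum_add_distrib, Finset.sum_range_succ, h2, Finset.sum_empty, add_zero,
    Finset.sum_range_succ' _ (m + 1), h3, Finset.sum_empty, add_zero]

end BraidedNA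

namespace BraidedNA

/-! ### Ranges of the letters of the words -/

theorem mem_seg {a b i n : ℕ} (h : i ∈ seg a b) (ha : 1 ≤ a) (hb : 1 ≤ b) (ha' : a ≤ n) (hb' : b ≤ n) :
    1 ≤ i ∧ i < n := by
  unfold seg at h
  split_ifs at h <;> simp at h <;> omega

theorem mem_shuffleWord {r n i : ℕ} {π : Equiv.Perm (Fin n)} (h : i ∈ shuffleWord r π) :
    1 ≤ i ∧ i < n := by
  rw [shuffleWord, List.mem_flatMap] at h
  obtain ⟨j, -, hj⟩ := h
  exact mem_seg hj (by omega) (by omega) j.2 (π j).2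

theorem mem_nu {r a n i : ℕ} (h : i ∈ nu r a n) (ha : 1 ≤ a) (har : a ≤ r + 1) : 1 ≤ i ∧ i < n := by
  rw [nu, List.mem_flatMap] at h
  obtain ⟨j, hj, hj'⟩ := h
  rw [List.mem_range] at hj
  exact mem_seg hj' (by omega) (by omega) (by omega) (by omega)

theorem seg_add (a b l : ℕ) : seg (l + a) (l + b) = shiftWord l (seg a b) := by
  unfold seg shiftWord
  split_ifs with h1 h2 h2 <;> (try omega) <;>
  simp [List.map_add_range', List.map_reverse, Nat.add_sub_add_left]

theorem seg_succ {a b : ℕ} (h : a ≤ b) : seg a (b + 1) = b :: seg a b := by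
  unfold seg
  rw [if_pos h, if_pos (by omega), Nat.sub_add_comm h, List.range'_concat]
  simp [h]

theorem nu_succ {r a n : ℕ} (h : r ≤ n) :
    nu r a (n + 1) = nu r a n ++ seg (a + (n - r)) (n + 1) := by
  have e : r + 1 + (n - r) = n + 1 := by omega
  rw [nu, nu, Nat.sub_add_comm h, List.range_succ, List.flatMap_append, List.flatMap_singleton, e]

theorem nu_add (r a n l : ℕ) : nu (l + r) (l + a) (l + n) = shiftWord l (nu r a n) := by
  rw [nu, nu, Nat.add_sub_add_left]
  simp only [shiftWord, List.map_flatMap]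
  congr 1
  ext1 j
  rw [show l + a + j = l + (a + j) by omega, show l + r + 1 + j = l + (r + 1 + j) by omega, seg_add]
  rfl

/-! ### Braid words, primitive strands and iterated products as diagrams. -/

namespace StrandCalculus

variable {R : Type*} [Ring R] (S : StrandCalculus R)

/-- The diagram of a word in the braid generators. -/
def act : List ℕ → R
  | [] => 1
  | i :: w => act w * S.sh (i - 1) S.t

theorem act_append (v w : List ℕ) : S.act (v ++ w) = S.act w * S.act v := by
  induction v with
  | nil => simp [act]
  | cons i v ih => simp [act, ih, mul_assoc]

theorem act_shiftWord (l : ℕ) (w : List ℕ) (h : ∀ i ∈ w, 1 ≤ i) :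
    S.act (shiftWord l w) = S.sh l (S.act w) := by
  induction w with
  | nil => simp [act, shiftWord]
  | cons i w ih =>
    have h1 := h i (by simp)
    have h2 := ih fun j hj => h j (by simp [hj])
    simp only [shiftWord] at h2
    simp only [shiftWord, List.map_cons, act, map_mul, sh_sh, h2, Nat.add_sub_assoc h1]

theorem act_far {N : ℕ} {w : List ℕ} (h : ∀ i ∈ w, 1 ≤ i ∧ i < N) {j : ℕ} (hj : N ≤ j) (f x : R) :
    S.act w * (S.sh j f * x) = S.sh j f * (S.act w * x) := by
  induction w generalizing x with
  | nil => simp [act]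
  | cons i w ih =>
    have := h i (by simp)
    simp only [act, mul_assoc]
    rw [S.t_far (by omega), ih fun j hj => h j (by simp [hj])]

theorem sh_act_far {l N : ℕ} {w : List ℕ} (h : ∀ i ∈ w, 1 ≤ i ∧ i < N) {j : ℕ} (hj : l + N ≤ j)
    (f x : R) : S.sh l (S.act w) * (S.sh j f * x) = S.sh j f * (S.sh l (S.act w) * x) := by
  obtain ⟨c, rfl⟩ := Nat.exists_eq_add_of_le hj
  have := S.sh_congr (S.act_far h le_rfl (S.sh c f) 1) l x
  simpa only [map_mul, map_one, mul_one, sh_sh, mul_assoc, add_assoc] using this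

/-- The strands `a, …, b - 1` of `f` are primitive. -/
def IsPrim (a b : ℕ) (f : R) : Prop := ∀ i, a ≤ i → i < b → S.sh i S.prim * f = 0

variable {S} in
theorem IsPrim.mono {a b a' b' : ℕ} {f : R} (hf : S.IsPrim a b f) (h : a ≤ a') (h' : b' ≤ b) :
    S.IsPrim a' b' f :=
  fun i hi hi' => hf i (h.trans hi) (hi'.trans_le h')

variable {S} in
theorem IsPrim.sh_mul {a b j : ℕ} {f : R} (hf : S.IsPrim a b f) (h : b ≤ j) (g : R) :
    S.IsPrim a b (S.sh j g * f) := fun i hi hi' => by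
  rw [S.prim_far (by omega), hf i hi hi', mul_zero]

theorem prim_t (i : ℕ) (x : R) : S.sh i S.prim * (S.sh i S.t * x) =
    S.sh (i + 1) S.t * (S.sh i S.t * (S.sh (i + 1) S.prim * x)) := by
  simp only [prim, map_sub, sub_mul, mul_sub, sh_sh, add_zero, d0_t]
  rw [S.t_eta1, S.eta_far le_rfl, S.t_far (j := i + 1 + 1) (by omega), S.t_eta1 (i + 1)]

theorem prim_succ_t (i : ℕ) (x : R) : S.sh (i + 1) S.prim * (S.sh i S.t * x) =
    S.sh i S.t * (S.sh (i + 1) S.t * (S.sh i S.prim * x)) := by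
  simp only [prim, map_sub, sub_mul, mul_sub, sh_sh, add_zero, d1_t]
  rw [← S.eta_far (i := i) le_rfl, S.t_eta0, S.t_eta0 (i + 1), S.t_far (j := i + 1 + 1) (by omega)]

variable {S} in
-- The primitivity defect slides through a crossing, so braiding primitive strands leaves them
-- primitive.
theorem IsPrim.t {a b i : ℕ} {f : R} (hf : S.IsPrim a b f) (ha : a ≤ i) (h : i + 1 < b) :
    S.IsPrim a b (S.sh i S.t * f) := by
  intro j hj hj'
  obtain h1 | rfl | rfl | h1 : j < i ∨ j = i ∨ j = i + 1 ∨ i + 1 < j := by omega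
  · rw [S.prim_far h1, hf j hj hj', mul_zero]
  · rw [prim_t, hf _ (by omega) h]; simp
  · rw [prim_succ_t, hf _ ha (by omega)]; simp
  · rw [← S.t_far h1, hf j hj hj', mul_zero]

variable {S} in
theorem IsPrim.sh_act {a b N : ℕ} {w : List ℕ} {f : R} (hf : S.IsPrim a b f)
    (h : ∀ i ∈ w, 1 ≤ i ∧ i < N) (hN : a + N ≤ b) : S.IsPrim a b (S.sh a (S.act w) * f) := by
  induction w generalizing f with
  | nil => simpa [StrandCalculus.act] using hf
  | cons i w ih =>
    have := h i (by simp)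
    rw [StrandCalculus.act, map_mul, sh_sh, mul_assoc]
    exact ih (hf.t (by omega) (by omega)) fun j hj => h j (by simp [hj])

/-- The left-to-right product of `n` strands. -/
def fold : ℕ → R
  | 0 => S.sh 0 S.eta
  | n + 1 => S.sh 0 S.mu * fold n

theorem fold_far (n : ℕ) {i j : ℕ} (h : i + n ≤ j) (f x : R) :
    S.sh i (S.fold n) * (S.sh j f * x) = S.sh (j + 1 - n) f * (S.sh i (S.fold n) * x) := by
  induction n generalizing x with
  | zero => simp only [fold, sh_sh, add_zero]; exact S.eta_far h f x
  | succ n ih =>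
    simp only [fold, map_mul, sh_sh, add_zero, mul_assoc]
    rw [ih (by omega), S.mu_far (by omega)]
    congr 3

theorem sh_fold_succ (i n : ℕ) (x : R) :
    S.sh i (S.fold (n + 1)) * x = S.sh i S.mu * (S.sh i (S.fold n) * x) := by
  simp only [fold, map_mul, sh_sh, add_zero, mul_assoc]

/-- Naturality of τ with respect to products: crossing a product with one strand amounts to crossing
its factors one by one. -/
theorem t_fold (a i : ℕ) (x : R) :
    S.sh i S.t * (S.sh i (S.fold a) * x) =
      S.sh (i + 1) (S.fold a) * (S.sh i (S.act (seg 1 (a + 1))) * x) := by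
  induction a generalizing x with
  | zero => simp [fold, sh_sh, seg, act, t_eta0]
  | succ a ih =>
    rw [sh_fold_succ, S.t_mu0, sh_fold_succ, seg_succ (by omega), act, map_mul, sh_sh, mul_assoc,
      ← ih, Nat.add_sub_cancel, S.fold_far a (by omega)]
    congr 5
    omega

/-- Crossing two products amounts to crossing two blocks of strands; this is where the braid ν comes
from. -/
theorem t_fold_fold (a s i : ℕ) (x : R) :
    S.sh i S.t * (S.sh i (S.fold a) * (S.sh (i + a) (S.fold s) * x)) =
      S.sh i (S.fold s) * (S.sh (i + s) (S.fold a) * (S.sh i (S.act (nu a 1 (a + s))) * x)) := by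
  induction s generalizing x with
  | zero =>
    have h : nu a 1 (a + 0) = [] := by simp [nu]
    rw [h]
    simp only [fold, sh_sh, add_zero, act, map_one, one_mul]
    rw [S.fold_far a le_rfl, show i + a + 1 - a = i + 1 by omega, S.t_eta1]
  | succ s ih =>
    have h : 1 + (a + s - a) = s + 1 := by omega
    have h2 : seg (s + 1) (a + s + 1) = shiftWord s (seg 1 (a + 1)) := by
      rw [← seg_add]; congr 1; omega
    have h3 (y : R) : S.sh i (S.fold s) * (S.sh (i + s) S.t * y) =
        S.sh (i + 1) S.t * (S.sh i (S.fold s) * y) := by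
      rw [S.fold_far s le_rfl, show i + s + 1 - s = i + 1 by omega]
    rw [sh_fold_succ, S.fold_far a (by omega), show i + a + 1 - a = i + 1 by omega, S.t_mu1, ih,
      sh_fold_succ, ← add_assoc a, nu_succ (by omega), h, h2, act_append, map_mul,
      act_shiftWord _ _ _ (fun j hj => (mem_seg hj (by omega) (by omega) le_add_self le_rfl).1), sh_sh,
      mul_assoc, show i + (s + 1) = i + s + 1 by omega, ← t_fold, h3]

end StrandCalculus

end BraidedNA

/-! ### Coproducts of products of primitives, and primitivity of the quotient. -/

namespace BraidedNA

namespace StrandCalculus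

variable {R : Type*} [Ring R] (S : StrandCalculus R)

theorem fold_far' (n : ℕ) {i j : ℕ} (h : i < j) (f x : R) :
    S.sh j f * (S.sh i (S.fold n) * x) = S.sh i (S.fold n) * (S.sh (j + n - 1) f * x) := by
  rw [S.fold_far n (by omega), show j + n - 1 + 1 - n = j by omega]

theorem fold_fold_far (r s : ℕ) {i j : ℕ} (h : i + 1 < j) (f x : R) :
    S.sh j f * (S.sh i (S.fold r) * (S.sh (i + r) (S.fold s) * x)) =
      S.sh i (S.fold r) * (S.sh (i + r) (S.fold s) * (S.sh (j + r + s - 2) f * x)) := by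
  rw [S.fold_far' r (by omega), S.fold_far' s (by omega),
    show j + r - 1 + s - 1 = j + r + s - 2 by omega]

theorem shuffles_zero (n : ℕ) : shuffles 0 n = {1} := by
  ext π
  rw [mem_shuffles, Finset.mem_singleton]
  constructor
  · rintro ⟨-, h⟩
    have h1 : StrictMono π := fun i j hij => h i j (Nat.zero_le _) hij
    have h2 := (h1.range_inj strictMono_id).1 (by simp [π.surjective.range_eq])
    exact Equiv.ext fun i => congrFun h2 i
  · rintro rfl
    exact ⟨fun i j h _ => h, fun i j _ h => h⟩

/-- Induction on `m`: multiplying by Δ(z) = 1 ⊗ z + z ⊗ 1 puts the new letter z at the end of the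
second or of the first word, which matches `sum_shuffles_succ`. -/
theorem d_fold (m i : ℕ) {f : R} (hf : S.IsPrim i (i + m) f) :
    S.sh i S.d * (S.sh i (S.fold m) * f) =
      ∑ r ∈ Finset.range (m + 1), ∑ π ∈ shuffles r m, S.sh i (S.fold r) *
        (S.sh (i + r) (S.fold (m - r)) * (S.sh i (S.act (shuffleWord r π)) * f)) := by
  induction m with
  | zero =>
    simp [shuffles_zero, fold, sh_sh, S.d_eta0, shuffleWord, act]
  | succ m ih =>
    have ih := ih (hf.mono le_rfl (by omega))
    rw [sum_shuffles_succ m fun r w => S.sh i (S.fold r) *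
        (S.sh (i + r) (S.fold (m + 1 - r)) * (S.sh i (S.act w) * f)),
      sh_fold_succ, d_mu_mm, ih, Finset.mul_sum, Finset.mul_sum]
    refine Finset.sum_congr rfl fun r hr => ?_
    have hr : r ≤ m := by simpa [Nat.lt_succ_iff] using hr
    rw [Finset.mul_sum, Finset.mul_sum]
    refine Finset.sum_congr rfl fun π _ => ?_
    have hw (j : ℕ) (hj : i + m ≤ j) (g x : R) := S.sh_act_far (l := i) (w := shuffleWord r π)
      (fun j hj => mem_shuffleWord hj) hj g x
    have e (c : ℕ) (g : R) : S.sh (i + 2 + c) g * (S.sh i (S.fold r) *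
        (S.sh (i + r) (S.fold (m - r)) * (S.sh i (S.act (shuffleWord r π)) * f))) =
        S.sh i (S.fold r) * (S.sh (i + r) (S.fold (m - r)) *
          (S.sh i (S.act (shuffleWord r π)) * (S.sh (i + m + c) g * f))) := by
      rw [S.fold_fold_far _ _ (by omega), hw _ (by omega)]
      congr 5
      omega
    have e0 := e 0
    simp only [add_zero] at e0
    have e1 := e 1
    rw [e0, d_of_prim (hf (i + m) (by omega) (by omega)), mul_add, mul_add, mul_add, ← e0, ← e1,
      mul_add, mm_eta2, mm_eta3]
    congr 1
    · rw [S.fold_far' r (by omega), Nat.sub_add_comm hr, sh_fold_succ]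
      congr 4
      omega
    -- In the term z ⊗ 1 the letter z must cross the whole second word; this crossing is the new
    -- segment of the shuffle word.
    · have h1 : seg (r + 1) (m + 1) = shiftWord r (seg 1 (m - r + 1)) := by
        rw [← seg_add]; congr 1; omega
      rw [S.fold_far' r (by omega), show i + 1 + r - 1 = i + r by omega, t_fold, sh_fold_succ,
        Nat.add_sub_add_right, act_append, h1, act_shiftWord, map_mul, sh_sh, mul_assoc, add_assoc]
      exact fun j hj => (mem_seg hj (by omega) (by omega) le_add_self le_rfl).1

/-- The word of the braid that distributes a pair of words according to a pair of shuffles. -/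
def pairWord (m r s : ℕ) {n : ℕ} (π : Equiv.Perm (Fin m)) (σ : Equiv.Perm (Fin n)) : List ℕ :=
  shuffleWord r π ++ shiftWord m (shuffleWord s σ) ++ nu m (r + 1) (m + s)

theorem mem_pairWord {m n r s i : ℕ} (hr : r ≤ m) (hs : s ≤ n) {π : Equiv.Perm (Fin m)}
    {σ : Equiv.Perm (Fin n)} (h : i ∈ pairWord m r s π σ) : 1 ≤ i ∧ i < m + n := by
  rw [pairWord, List.mem_append, List.mem_append] at h
  obtain (h | h) | h := h
  · have := mem_shuffleWord h
    omega
  · rw [shiftWord, List.mem_map] at h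
    obtain ⟨j, hj, rfl⟩ := h
    have := mem_shuffleWord hj
    omega
  · have := mem_nu h (by omega) (by omega)
    omega

theorem act_pairWord {m n r s : ℕ} (hr : r ≤ m) (π : Equiv.Perm (Fin m)) (σ : Equiv.Perm (Fin n)) :
    S.act (pairWord m r s π σ) = S.sh r (S.act (nu (m - r) 1 (m - r + s))) *
      (S.sh m (S.act (shuffleWord s σ)) * S.act (shuffleWord r π)) := by
  have h1 : nu m (r + 1) (m + s) = shiftWord r (nu (m - r) 1 (m - r + s)) := by
    rw [← nu_add]; congr 1 <;> omega
  rw [pairWord, act_append, act_append, h1, act_shiftWord, act_shiftWord]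
  · exact fun j hj => (mem_shuffleWord hj).1
  · exact fun j hj => (mem_nu hj le_rfl (by omega)).1

/-- `d_fold` is applied to each word; the middle crossing then exchanges R_{m-r} with R_s and
contributes ν. -/
theorem dd_fold_fold (m n i : ℕ) {f : R} (hf : S.IsPrim i (i + (m + n)) f) :
    S.sh i S.dd * (S.sh i (S.fold m) * (S.sh (i + m) (S.fold n) * f)) =
      ∑ r ∈ Finset.range (m + 1), ∑ s ∈ Finset.range (n + 1),
        ∑ π ∈ shuffles r m, ∑ σ ∈ shuffles s n,
          S.sh i (S.fold r) * (S.sh (i + r) (S.fold s) *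
            (S.sh (i + r + s) (S.fold (m - r)) * (S.sh (i + m + s) (S.fold (n - s)) *
              (S.sh i (S.act (pairWord m r s π σ)) * f)))) := by
  simp only [dd, map_mul, sh_sh, mul_assoc, add_zero]
  rw [S.d_fold m i ((hf.mono le_rfl (by omega)).sh_mul le_rfl _)]
  simp only [Finset.mul_sum]
  refine Finset.sum_congr rfl fun r hr => ?_
  have hr : r ≤ m := by simpa [Nat.lt_succ_iff] using hr
  rw [Finset.sum_comm]
  refine Finset.sum_congr rfl fun π _ => ?_
  have hw {j : ℕ} (hj : i + m ≤ j) (g x : R) := S.sh_act_far (l := i) (w := shuffleWord r π)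
    (fun j hj => mem_shuffleWord hj) hj g x
  rw [S.fold_fold_far _ _ (by omega), show i + 2 + r + (m - r) - 2 = i + m by omega,
    ← hw le_rfl, S.d_fold n (i + m) (hf.mono (by omega) (by omega))]
  simp only [Finset.mul_sum]
  refine Finset.sum_congr rfl fun s hs => Finset.sum_congr rfl fun σ _ => ?_
  have h2 := S.t_fold_fold (m - r) s (i + r)
  rw [show i + r + (m - r) = i + m by omega] at h2
  rw [S.fold_far' r (by omega), show i + 1 + r - 1 = i + r by omega, hw le_rfl, hw (by omega),
    hw (by omega), h2, S.sh_act_far (fun j hj => mem_nu hj le_rfl (by omega)) (by omega),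
    S.act_pairWord hr]
  simp only [map_mul, sh_sh, mul_assoc]

/-- Primitives are cocommutative, and by `t_d_mu` so are their products. -/
theorem t_d_fold (m i : ℕ) {f : R} (hf : S.IsPrim i (i + m) f) :
    S.sh i S.t * (S.sh i S.d * (S.sh i (S.fold m) * f)) =
      S.sh i S.d * (S.sh i (S.fold m) * f) := by
  induction m with
  | zero =>
    simp only [fold, sh_sh, add_zero, d_eta0, t_eta0]
    rw [S.eta_far le_rfl]
  | succ m ih =>
    rw [sh_fold_succ]
    refine S.t_d_mu (ih (hf.mono le_rfl (by omega))) ?_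
    rw [S.fold_far' m (by omega), S.fold_far' m (by omega), show i + 1 + m - 1 = i + m by omega,
      d_of_prim (hf (i + m) (by omega) (by omega)), mul_add, t_eta0, t_eta1, add_comm]

theorem t_d_fold_succ (m n i : ℕ) {f : R} (hf : S.IsPrim (i + m) (i + m + n) f) :
    S.sh (i + 1) S.t * (S.sh (i + 1) S.d * (S.sh i (S.fold m) * (S.sh (i + m) (S.fold n) * f))) =
      S.sh (i + 1) S.d * (S.sh i (S.fold m) * (S.sh (i + m) (S.fold n) * f)) := by
  rw [S.fold_far' m (by omega), S.fold_far' m (by omega), show i + 1 + m - 1 = i + m by omega,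
    S.t_d_fold n (i + m) hf]

/-- The factor x₁y₁ of the convolution is cocommutative too, since over shuffles it becomes a
product R_r R_s of primitives. -/
theorem t_d_mu_dd_fold (m n i : ℕ) {f : R} (hf : S.IsPrim i (i + (m + n)) f) :
    S.sh i S.t * (S.sh i S.d * (S.sh i S.mu * (S.sh i S.dd *
      (S.sh i (S.fold m) * (S.sh (i + m) (S.fold n) * f))))) =
    S.sh i S.d * (S.sh i S.mu * (S.sh i S.dd *
      (S.sh i (S.fold m) * (S.sh (i + m) (S.fold n) * f)))) := by
  rw [S.dd_fold_fold m n i hf]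
  simp only [Finset.mul_sum]
  refine Finset.sum_congr rfl fun r hr => Finset.sum_congr rfl fun s hs =>
    Finset.sum_congr rfl fun π _ => Finset.sum_congr rfl fun σ _ => ?_
  rw [Finset.mem_range] at hr hs
  have h := (((hf.sh_act (fun j hj => mem_pairWord (π := π) (σ := σ) (Nat.lt_succ_iff.1 hr)
    (Nat.lt_succ_iff.1 hs) hj) le_rfl).mono (b' := i + r + s) le_rfl (by omega)).sh_mul
    (j := i + m + s) (by omega) (S.fold (n - s))).sh_mul (j := i + r + s) le_rfl (S.fold (m - r))
  exact S.t_d_mu (S.t_d_fold r i ((h.mono le_rfl (by omega)).sh_mul le_rfl _))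
    (S.t_d_fold_succ r s i (h.mono (by omega) le_rfl))

theorem assoc_mu_dd (i : ℕ) (x : R) :
    S.sh (i + 1) S.assoc * (S.sh i S.mu * (S.sh i S.dd * x)) =
      S.sh (i + 1) S.mu * (S.sh (i + 2) S.quot * (S.sh i S.d * (S.sh i S.mu * (S.sh i S.dd * x)))) := by
  rw [← mu_dd_mu_dd, ← S.mu_quot (i + 1)]

/-- The quotient operation is primitive on products of primitive strands, after convolution. -/
theorem mm_d_prim_quot (m n i : ℕ) {f : R} (hf : S.IsPrim i (i + (m + n + 1)) f) :
    S.sh i S.mm * (S.sh i S.d * (S.sh (i + 1) S.prim * (S.sh (i + 1) S.quot * (S.sh i S.mu *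
      (S.sh i S.dd * (S.sh i (S.fold m) * (S.sh (i + m) (S.fold n) * f))))))) = 0 := by
  set x := S.sh i (S.fold m) * (S.sh (i + m) (S.fold n) * f) with hx
  have h0 : S.sh i S.t * (S.sh i S.d * x) = S.sh i S.d * x :=
    S.t_d_fold m i ((hf.mono le_rfl (by omega)).sh_mul le_rfl _)
  have h1 : S.sh (i + 1) S.t * (S.sh (i + 1) S.d * x) = S.sh (i + 1) S.d * x :=
    S.t_d_fold_succ m n i (hf.mono (by omega) (by omega))
  have h2 : S.sh (i + 2) S.prim * x = 0 := by
    rw [hx, S.fold_fold_far _ _ (by omega), hf _ (by omega) (by omega)]; simp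
  have h3 := S.t_d_mu_dd_fold m n i (hf.mono le_rfl (by omega))
  rw [← hx] at h3
  have h4 := S.d_assoc_of_prim h0 h1 h2
  set y := S.sh i S.d * (S.sh i S.mu * (S.sh i S.dd * x)) with hy
  have h5 : S.sh (i + 2) S.t * (S.sh (i + 2) S.eta * (S.sh (i + 2) S.quot * y)) =
    S.sh (i + 3) S.eta * (S.sh (i + 2) S.quot * y) := S.t_eta0 (i + 2) _
  -- The first summand becomes Δ(x₁y₁) · (1 ⊗ Q). By `t_mm` and cocommutativity of x₁y₁, the second
  -- becomes Δ(x₁y₁) · (Q ⊗ 1). The left side becomes Δ(x₁y₁) · Δ(Q).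
  rw [assoc_mu_dd, ← hy, ← S.mm_eta2, t_mm, h5, S.t_far (by omega), S.t_far (by omega), h3,
    ← S.mu_quot, d_mu_mm, S.d_far (j := i + 1) (by omega)] at h4
  rw [S.d_far (j := i + 1) (by omega), S.d_far (j := i + 1) (by omega), ← hy]
  simp only [prim, map_sub, sub_mul, mul_sub, sh_sh, add_zero]
  simp only [add_assoc, Nat.reduceAdd] at h4 ⊢
  rw [hy, h4]
  abel

theorem mu_fold_fold_far (r s : ℕ) {i j : ℕ} (h : i < j) (f x : R) :
    S.sh j f * (S.sh i S.mu * (S.sh i (S.fold r) * (S.sh (i + r) (S.fold s) * x))) =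
      S.sh i S.mu * (S.sh i (S.fold r) * (S.sh (i + r) (S.fold s) * (S.sh (j + r + s - 1) f * x))) := by
  have h1 := S.mu_far (i := i) (j := j + 1) (by omega) f
  simp only [Nat.add_sub_cancel] at h1
  rw [← h1, S.fold_fold_far _ _ (by omega), show j + 1 + r + s - 2 = j + r + s - 1 by omega]

theorem mm_eta_eta (i : ℕ) (x : R) : S.sh i S.mm * (S.sh i S.eta * (S.sh i S.eta * x)) = x := by
  simp only [mm, map_mul, sh_sh, mul_assoc, add_zero]
  rw [← S.eta_far le_rfl, S.t_eta0, S.mu_eta0, S.mu_eta0]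

theorem pairWord_zero (m n : ℕ) :
    pairWord m 0 0 (1 : Equiv.Perm (Fin m)) (1 : Equiv.Perm (Fin n)) = [] := by
  simp [pairWord, shuffleWord, shiftWord, nu]

/-- Triangularity: in the expansion of `mm_d_prim_quot`, a term with r + s > 0 contains the defect
of the quotient for shorter words, zero by induction. The term r = s = 0 has left factor Δ(1) = 1 ⊗
1. -/
theorem prim_quot_fold (m n i : ℕ) {f : R} (hf : S.IsPrim i (i + (m + n + 1)) f) :
    S.sh i S.prim * (S.sh i S.quot * (S.sh i (S.fold m) * (S.sh (i + m) (S.fold n) * f))) = 0 := by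
  induction h : m + n using Nat.strong_induction_on generalizing m n i f with
  | _ N ih =>
    subst h
    have key := S.mm_d_prim_quot m n i hf
    rw [S.dd_fold_fold m n i (hf.mono le_rfl (by omega))] at key
    simp only [Finset.mul_sum] at key
    have vanish (r s : ℕ) (hr : r ∈ Finset.range (m + 1)) (hs : s ∈ Finset.range (n + 1))
        (hrs : 0 < r + s) (π : Equiv.Perm (Fin m)) (σ : Equiv.Perm (Fin n)) :
        S.sh i S.mm * (S.sh i S.d * (S.sh (i + 1) S.prim * (S.sh (i + 1) S.quot *
          (S.sh i S.mu * (S.sh i (S.fold r) * (S.sh (i + r) (S.fold s) *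
            (S.sh (i + r + s) (S.fold (m - r)) * (S.sh (i + m + s) (S.fold (n - s)) *
              (S.sh i (S.act (pairWord m r s π σ)) * f))))))))) = 0 := by
      rw [Finset.mem_range] at hr hs
      have hf' := hf.sh_act (fun j hj => mem_pairWord (π := π) (σ := σ) (Nat.lt_succ_iff.1 hr)
        (Nat.lt_succ_iff.1 hs) hj) (by omega)
      have h1 := ih (m - r + (n - s)) (by omega) (m - r) (n - s) (i + r + s)
        (hf'.mono (by omega) (by omega)) rfl
      rw [show i + r + s + (m - r) = i + m + s by omega] at h1
      rw [S.mu_fold_fold_far _ _ (by omega), S.mu_fold_fold_far _ _ (by omega),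
        show i + 1 + r + s - 1 = i + r + s by omega, h1]
      simp only [mul_zero]
    rw [Finset.sum_eq_single_of_mem 0 (by simp), Finset.sum_eq_single_of_mem 0 (by simp)] at key
    · have e (g y : R) : S.sh (i + 1) g * (S.sh i S.eta * y) = S.sh i S.eta * (S.sh i g * y) :=
        (S.eta_far le_rfl _ _).symm
      simp only [shuffles_zero, Finset.sum_singleton, pairWord_zero, act, map_one, one_mul, add_zero,
        Nat.sub_zero, fold, sh_sh, mu_eta0, e, d_eta0, mm_eta_eta] at key
      exact key
    · intro s hs hs0
      exact Finset.sum_eq_zero fun π _ => Finset.sum_eq_zero fun σ _ =>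
        vanish 0 s (by simp) hs (by omega) π σ
    · intro r hr hr0
      exact Finset.sum_eq_zero fun s hs => Finset.sum_eq_zero fun π _ =>
        Finset.sum_eq_zero fun σ _ => vanish r s hr hs (by omega) π σ

/-- This is `mu_quot` expanded over shuffles. It has the shape of the recursion for P_{m,n}, with
the quotient in the place of the operations. -/
theorem assoc_fold_fold (m n i : ℕ) {f : R} (hf : S.IsPrim i (i + (m + n)) f) :
    S.sh i S.assoc * (S.sh i (S.fold m) * (S.sh (i + m) (S.fold n) * f)) =
      ∑ r ∈ Finset.range m, ∑ s ∈ Finset.range n,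
        ∑ π ∈ shuffles r m, ∑ σ ∈ shuffles s n,
          S.sh i S.mu * (S.sh i S.mu * (S.sh i (S.fold r) * (S.sh (i + r) (S.fold s) *
            (S.sh (i + r + s) S.quot * (S.sh (i + r + s) (S.fold (m - r)) *
              (S.sh (i + m + s) (S.fold (n - s)) *
                (S.sh i (S.act (pairWord m r s π σ)) * f))))))) := by
  have e (r s : ℕ) (y : R) := S.mu_fold_fold_far r s (i := i) (j := i + 1) (by omega) S.quot y
  have e1 (r s : ℕ) : i + 1 + r + s - 1 = i + r + s := by omega
  simp only [e1] at e
  rw [← mu_quot, S.dd_fold_fold m n i hf]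
  simp only [Finset.mul_sum, e]
  -- The terms r = m and s = n have an argument R_0 = 1 in the quotient, so they vanish.
  rw [Finset.sum_range_succ, Finset.sum_eq_zero (s := Finset.range (n + 1)), add_zero]
  · refine Finset.sum_congr rfl fun r hr => ?_
    rw [Finset.mem_range] at hr
    rw [Finset.sum_range_succ]
    refine add_eq_left.2 (Finset.sum_eq_zero fun π _ => Finset.sum_eq_zero fun σ _ => ?_)
    simp only [Nat.sub_self, fold, sh_sh, add_zero]
    rw [S.fold_far (m - r) (i := i + r + n) (by omega),
      show i + m + n + 1 - (m - r) = i + r + n + 1 by omega, quot_eta1]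
    simp only [mul_zero]
  · intro s _
    refine Finset.sum_eq_zero fun π _ => Finset.sum_eq_zero fun σ _ => ?_
    simp only [Nat.sub_self, fold, sh_sh, add_zero, quot_eta0, mul_zero]

/-- The diagram of the braided Shestakov–Umirbaev operation. -/
def suDiagram (m n : ℕ) : R :=
  S.assoc * (S.fold m * S.sh m (S.fold n)) -
    ∑ r : Fin m, ∑ s : Fin n,
      if _h : 0 < r.val + s.val then
        ∑ π ∈ shuffles r.val m, ∑ σ ∈ shuffles s.val n,
          S.mu * S.mu * (S.fold r.val * (S.sh r.val (S.fold s.val) *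
            S.sh (r.val + s.val) (suDiagram (m - r.val) (n - s.val)))) *
              S.act (pairWord m r.val s.val π σ)
      else 0
termination_by m + n
decreasing_by omega

/-- On primitive strands, the Shestakov–Umirbaev operation is the convolution quotient. -/
theorem suDiagram_mul (m n i : ℕ) (hm : 1 ≤ m) (hn : 1 ≤ n) {f : R}
    (hf : S.IsPrim i (i + (m + n)) f) :
    S.sh i (S.suDiagram m n) * f =
      S.sh i S.quot * (S.sh i (S.fold m) * (S.sh (i + m) (S.fold n) * f)) := by
  induction h : m + n using Nat.strong_induction_on generalizing m n i f with
  | _ N ih =>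
    subst h
    have key := S.assoc_fold_fold m n i hf
    rw [suDiagram, map_sub, sub_mul, map_mul, map_mul, sh_sh, mul_assoc, mul_assoc, key,
      sub_eq_iff_eq_add, Finset.sum_range, map_sum, Finset.sum_mul]
    simp only [Finset.sum_range, map_sum, Finset.sum_mul]
    -- The leading term is spread over all pairs (r, s) as an indicator of (0, 0), so that both
    -- sides can be compared termwise.
    have h0 : S.sh i S.quot * (S.sh i (S.fold m) * (S.sh (i + m) (S.fold n) * f)) =
        ∑ r : Fin m, ∑ s : Fin n, if r = ⟨0, hm⟩ then if s = ⟨0, hn⟩ then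
          S.sh i S.quot * (S.sh i (S.fold m) * (S.sh (i + m) (S.fold n) * f)) else 0 else 0 := by
      simp
    rw [h0, ← Finset.sum_add_distrib]
    refine Finset.sum_congr rfl fun r _ => ?_
    rw [← Finset.sum_add_distrib]
    refine Finset.sum_congr rfl fun s _ => ?_
    obtain ⟨r, hr⟩ := r
    obtain ⟨s, hs⟩ := s
    simp only [Fin.mk.injEq]
    by_cases hrs : 0 < r + s
    · have h1 : ¬ (r = 0 ∧ s = 0) := by omega
      rw [dif_pos hrs, ← ite_and, if_neg h1, zero_add]
      simp only [map_sum, Finset.sum_mul]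
      refine Finset.sum_congr rfl fun π _ => Finset.sum_congr rfl fun σ _ => ?_
      have hf' := hf.sh_act (fun j hj => mem_pairWord (π := π) (σ := σ) hr.le hs.le hj) (by omega)
      have h2 := ih (m - r + (n - s)) (by omega) (m - r) (n - s) (i + r + s) (by omega) (by omega)
        (hf'.mono (by omega) (by omega)) rfl
      rw [show i + r + s + (m - r) = i + m + s by omega] at h2
      simp only [map_mul, sh_sh, mul_assoc, ← add_assoc]
      rw [h2]
    · obtain ⟨rfl, rfl⟩ : r = 0 ∧ s = 0 := by omega
      simp [shuffles_zero, pairWord_zero, act, fold, sh_sh, mu_eta0]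

theorem prim_suDiagram (m n : ℕ) (hm : 1 ≤ m) (hn : 1 ≤ n) {f : R}
    (hf : S.IsPrim 0 (m + n + 1) f) : S.prim * (S.suDiagram m n * f) = 0 := by
  have h1 := S.suDiagram_mul m n 0 hm hn (hf.mono le_rfl (by omega))
  have h2 := S.prim_quot_fold m n 0 (by simpa using hf)
  rw [← h1] at h2
  exact h2

end StrandCalculus

end BraidedNA

/-! ### Realization of the calculus by operators on a module W with B ⊗ W ≃ W. -/

open scoped TensorProduct

noncomputable section

namespace BraidedNA

namespace Strand

section Module

variable {k B W : Type*} [Field k] [AddCommGroup B] [Module k B] [AddCommGroup W] [Module k W]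
  (φ : B ⊗[k] W ≃ₗ[k] W)

/-- The operator that puts the strand `x` in front. -/
def cons : B →ₗ[k] Module.End k W := (TensorProduct.mk k B W).compr₂ φ.toLinearMap

theorem cons_apply (x : B) (w : W) : cons φ x w = φ (x ⊗ₜ w) := rfl

/-- The operator that removes the first strand and applies `g` to it. -/
def op : (B →ₗ[k] Module.End k W) →ₗ[k] Module.End k W :=
  LinearMap.lcomp k W φ.symm.toLinearMap ∘ₗ (TensorProduct.uncurry (.id k) B W W)

@[simp]
theorem op_mul_cons (g : B →ₗ[k] Module.End k W) (x : B) : op φ g * cons φ x = g x := by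
  ext w
  simp [op, cons_apply]

@[simp]
theorem op_mul_cons_mul (g : B →ₗ[k] Module.End k W) (x : B) (f : Module.End k W) :
    op φ g * (cons φ x * f) = g x * f := by
  rw [← mul_assoc, op_mul_cons]

/-- As `φ` is surjective, every vector is a sum of vectors with a first strand split off. -/
theorem ext_cons {f g : Module.End k W} (h : ∀ x, f * cons φ x = g * cons φ x) : f = g := by
  have h1 : f ∘ₗ φ.toLinearMap = g ∘ₗ φ.toLinearMap := by
    ext x w
    exact LinearMap.congr_fun (h x) w
  ext w
  simpa using LinearMap.congr_fun h1 (φ.symm w)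

/-- The operator `f` applied behind the first strand. -/
def shift : Module.End k W →+* Module.End k W where
  toFun f := op φ ((LinearMap.mul k (Module.End k W)).flip f ∘ₗ cons φ)
  map_one' := ext_cons φ fun x => by simp
  map_mul' f g := ext_cons φ fun x => by simp [mul_assoc]
  map_zero' := by simp
  map_add' f g := ext_cons φ fun x => by simp [add_mul]

@[simp]
theorem shift_mul_cons (f : Module.End k W) (x : B) : shift φ f * cons φ x = cons φ x * f := by
  simp [shift]

@[simp]
theorem shift_mul_cons_mul (f g : Module.End k W) (x : B) :
    shift φ f * (cons φ x * g) = cons φ x * (f * g) := by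
  rw [← mul_assoc, shift_mul_cons, mul_assoc]

/-- The operator that puts two strands in front. -/
def cons₂ : B ⊗[k] B →ₗ[k] Module.End k W :=
  LinearMap.mul' k _ ∘ₗ TensorProduct.map (cons φ) (cons φ)

@[simp]
theorem cons₂_tmul (x y : B) : cons₂ φ (x ⊗ₜ y) = cons φ x * cons φ y := by simp [cons₂]

/-- The operator that puts three strands in front. -/
def cons₃ : B ⊗[k] (B ⊗[k] B) →ₗ[k] Module.End k W :=
  LinearMap.mul' k _ ∘ₗ TensorProduct.map (cons φ) (cons₂ φ)

@[simp]
theorem cons₃_tmul (x : B) (z : B ⊗[k] B) : cons₃ φ (x ⊗ₜ z) = cons φ x * cons₂ φ z := by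
  simp [cons₃]

theorem cons₃_assoc (z : B ⊗[k] B) (x : B) :
    cons₃ φ (TensorProduct.assoc k B B B (z ⊗ₜ x)) = cons₂ φ z * cons φ x := by
  induction z with
  | zero => simp
  | tmul a b => simp [mul_assoc]
  | add a b ha hb => rw [TensorProduct.add_tmul, map_add, map_add, ha, hb, map_add, add_mul]

theorem cons₂_ext {f g : Module.End k W} (h : ∀ z, f * cons₂ φ z = g * cons₂ φ z) : f = g :=
  ext_cons φ fun x => ext_cons φ fun y => by simpa [mul_assoc] using h (x ⊗ₜ y)

theorem cons₃_ext {f g : Module.End k W} (h : ∀ z, f * cons₃ φ z = g * cons₃ φ z) : f = g :=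
  ext_cons φ fun x => cons₂_ext φ fun z => by simpa [mul_assoc] using h (x ⊗ₜ z)

/-- Evaluation at w is z ↦ z ⊗ w followed by isomorphisms, and over a field z ⊗ w = 0 with w ≠ 0
forces z = 0. -/
theorem cons₂_injective [Nontrivial W] : Function.Injective (cons₂ φ) := by
  rw [← LinearMap.ker_eq_bot, LinearMap.ker_eq_bot']
  intro z hz
  obtain ⟨w, hw⟩ := exists_ne (0 : W)
  have h1 (z : B ⊗[k] B) (w : W) :
      cons₂ φ z w = φ ((φ.toLinearMap.lTensor B) (TensorProduct.assoc k B B W (z ⊗ₜ w))) := by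
    induction z with
    | zero => simp
    | tmul a b => simp [cons_apply]
    | add a b ha hb => simp only [TensorProduct.add_tmul, map_add, LinearMap.add_apply, ha, hb]
  have h2 : z ⊗ₜ[k] w = 0 := by
    have := (h1 z w).symm.trans (LinearMap.congr_fun hz w)
    have h3 : φ.toLinearMap.lTensor B (TensorProduct.assoc k B B W (z ⊗ₜ w)) = 0 := by
      simpa only [LinearMap.zero_apply, EmbeddingLike.map_eq_zero_iff] using this
    have h4 : LinearEquiv.lTensor B φ (TensorProduct.assoc k B B W (z ⊗ₜ w)) = 0 := h3
    simpa only [EmbeddingLike.map_eq_zero_iff] using h4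
  by_contra hz0
  refine hw ((Module.forall_dual_apply_eq_zero_iff k w).1 fun g => ?_)
  have h3 := congrArg ((TensorProduct.rid k _).toLinearMap ∘ₗ g.lTensor (B ⊗[k] B)) h2
  simpa [hz0] using h3

/-- The operator that removes the first two strands and applies `g` to them. -/
def op₂ (g : B ⊗[k] B →ₗ[k] Module.End k W) : Module.End k W :=
  op φ (op φ ∘ₗ TensorProduct.curry g)

@[simp]
theorem op₂_mul (g : B ⊗[k] B →ₗ[k] Module.End k W) (z : B ⊗[k] B) :
    op₂ φ g * cons₂ φ z = g z := by
  induction z with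
  | zero => simp
  | tmul a b => simp [op₂]
  | add a b ha hb => simp [mul_add, ha, hb]

@[simp]
theorem op₂_mul_mul (g : B ⊗[k] B →ₗ[k] Module.End k W) (z : B ⊗[k] B) (f : Module.End k W) :
    op₂ φ g * (cons₂ φ z * f) = g z * f := by
  rw [← mul_assoc, op₂_mul]

@[simp]
theorem shift_shift_mul (f : Module.End k W) (z : B ⊗[k] B) :
    shift φ (shift φ f) * cons₂ φ z = cons₂ φ z * f := by
  induction z with
  | zero => simp
  | tmul a b => simp [mul_assoc]
  | add a b ha hb => simp [mul_add, add_mul, ha, hb]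

/-- The operator of a linear map `B ⊗ B → B ⊗ B` on the first two strands. -/
def t (τ : B ⊗[k] B →ₗ[k] B ⊗[k] B) : Module.End k W := op₂ φ (cons₂ φ ∘ₗ τ)

theorem t_mul_cons₂ (τ : B ⊗[k] B →ₗ[k] B ⊗[k] B) (z : B ⊗[k] B) :
    t φ τ * cons₂ φ z = cons₂ φ (τ z) := by simp [t]

theorem t_mul_cons₃ (τ : B ⊗[k] B →ₗ[k] B ⊗[k] B) (z : B ⊗[k] (B ⊗[k] B)) :
    t φ τ * cons₃ φ z = cons₃ φ (tauOne τ z) := by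
  induction z with
  | zero => simp
  | tmul a z =>
    induction z with
    | zero => simp
    | tmul b c =>
      have := t_mul_cons₂ φ τ (a ⊗ₜ b)
      simp only [cons₂_tmul] at this
      simp [tauOne, cons₃_assoc, ← mul_assoc, this]
    | add a b ha hb => simp only [TensorProduct.tmul_add, map_add, mul_add, ha, hb]
  | add a b ha hb => simp only [map_add, mul_add, ha, hb]

theorem shift_t_mul_cons₃ (τ : B ⊗[k] B →ₗ[k] B ⊗[k] B) (z : B ⊗[k] (B ⊗[k] B)) :
    shift φ (t φ τ) * cons₃ φ z = cons₃ φ (tauTwo τ z) := by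
  induction z with
  | zero => simp
  | tmul a z => simp [tauTwo, t_mul_cons₂]
  | add a b ha hb => simp only [map_add, mul_add, ha, hb]

theorem op₂_cons₂_nat (g : B ⊗[k] B →ₗ[k] B ⊗[k] B) (f : Module.End k W) :
    op₂ φ (cons₂ φ ∘ₗ g) * shift φ (shift φ f) = shift φ (shift φ f) * op₂ φ (cons₂ φ ∘ₗ g) :=
  cons₂_ext φ fun z => by simp [mul_assoc]

theorem op₂_cons_nat (g : B ⊗[k] B →ₗ[k] B) (f : Module.End k W) :
    op₂ φ (cons φ ∘ₗ g) * shift φ (shift φ f) = shift φ f * op₂ φ (cons φ ∘ₗ g) :=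
  cons₂_ext φ fun z => by simp [mul_assoc]

theorem op_cons₂_nat (g : B →ₗ[k] B ⊗[k] B) (f : Module.End k W) :
    op φ (cons₂ φ ∘ₗ g) * shift φ f = shift φ (shift φ f) * op φ (cons₂ φ ∘ₗ g) :=
  ext_cons φ fun z => by simp [mul_assoc]

end Module

section Coalgebra

variable {k B W : Type*} [Field k] [AddCommGroup B] [Module k B] [Coalgebra k B]
  [AddCommGroup W] [Module k W] (φ : B ⊗[k] W ≃ₗ[k] W)

/-- The operator that applies the coproduct to the first strand. -/
def d : Module.End k W := op φ (cons₂ φ ∘ₗ Coalgebra.comul (R := k) (A := B))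

theorem d_mul_cons (x : B) : d φ * cons φ x = cons₂ φ (Coalgebra.comul (R := k) x) := by
  simp [d]

theorem d_mul_cons₂ (z : B ⊗[k] B) : d φ * cons₂ φ z = cons₃ φ (comulOne k B z) := by
  induction z with
  | zero => simp
  | tmul a b => simp [comulOne, cons₃_assoc, ← mul_assoc, d_mul_cons]
  | add a b ha hb => simp only [map_add, mul_add, ha, hb]

theorem shift_d_mul_cons₂ (z : B ⊗[k] B) : shift φ (d φ) * cons₂ φ z = cons₃ φ (comulTwo k B z) := by
  induction z with
  | zero => simp
  | tmul a b => simp [comulTwo, d_mul_cons]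
  | add a b ha hb => simp only [map_add, mul_add, ha, hb]

/-- The operator that applies the counit to the first strand. -/
def eps : Module.End k W :=
  op φ ((LinearMap.toSpanSingleton k (Module.End k W) 1) ∘ₗ Coalgebra.counit (R := k) (A := B))

theorem eps_mul_cons (x : B) : eps φ * cons φ x = Coalgebra.counit (R := k) x • 1 := by
  simp [eps]

theorem eps_mul_cons₂ (z : B ⊗[k] B) : eps φ * cons₂ φ z = cons φ (counitOne k B z) := by
  induction z with
  | zero => simp
  | tmul a b => simp [counitOne, ← mul_assoc, eps_mul_cons]
  | add a b ha hb => simp only [map_add, mul_add, ha, hb]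

theorem shift_eps_mul_cons₂ (z : B ⊗[k] B) :
    shift φ (eps φ) * cons₂ φ z = cons φ (counitTwo k B z) := by
  induction z with
  | zero => simp
  | tmul a b => simp [counitTwo, eps_mul_cons]
  | add a b ha hb => simp only [map_add, mul_add, ha, hb]

theorem d_d : d φ * d φ = shift φ (d φ) * d φ :=
  ext_cons φ fun x => by
    rw [mul_assoc, mul_assoc, d_mul_cons, d_mul_cons₂, shift_d_mul_cons₂]
    exact congrArg _ (Coalgebra.coassoc_apply x)

theorem eps_d : eps φ * d φ = 1 :=
  ext_cons φ fun x => by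
    rw [mul_assoc, d_mul_cons, eps_mul_cons₂, counitOne, LinearMap.comp_apply,
      Coalgebra.rTensor_counit_comul]
    simp

theorem shift_eps_d : shift φ (eps φ) * d φ = 1 :=
  ext_cons φ fun x => by
    rw [mul_assoc, d_mul_cons, shift_eps_mul_cons₂, counitTwo, LinearMap.comp_apply,
      Coalgebra.lTensor_counit_comul]
    simp

end Coalgebra

section Hopf

variable {k B W : Type*} [Field k] [NonAssocRing B] [Module k B] [SMulCommClass k B B]
  [IsScalarTower k B B] [AddCommGroup W] [Module k W] (φ : B ⊗[k] W ≃ₗ[k] W)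

/-- The operator that multiplies the first two strands. -/
def mu : Module.End k W := op₂ φ (cons φ ∘ₗ LinearMap.mul' k B)

theorem mu_mul_cons₂ (z : B ⊗[k] B) : mu φ * cons₂ φ z = cons φ (LinearMap.mul' k B z) := by
  simp [mu]

theorem mu_mul_cons₃ (z : B ⊗[k] (B ⊗[k] B)) : mu φ * cons₃ φ z = cons₂ φ (mulOne k B z) := by
  induction z with
  | zero => simp
  | tmul a z =>
    induction z with
    | zero => simp
    | tmul b c =>
      have := mu_mul_cons₂ φ (a ⊗ₜ b)
      simp only [cons₂_tmul] at this
      simp [mulOne, ← mul_assoc, this]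
    | add a b ha hb => simp only [TensorProduct.tmul_add, map_add, mul_add, ha, hb]
  | add a b ha hb => simp only [map_add, mul_add, ha, hb]

theorem shift_mu_mul_cons₃ (z : B ⊗[k] (B ⊗[k] B)) :
    shift φ (mu φ) * cons₃ φ z = cons₂ φ (mulTwo k B z) := by
  induction z with
  | zero => simp
  | tmul a z => simp [mulTwo, mu_mul_cons₂]
  | add a b ha hb => simp only [map_add, mul_add, ha, hb]

/-- The operator that inserts a first strand `1`. -/
def eta : Module.End k W := cons φ 1

theorem mu_eta : mu φ * eta φ = 1 :=
  ext_cons φ fun x => by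
    have := mu_mul_cons₂ φ (1 ⊗ₜ x)
    simpa [eta, mul_assoc] using this

theorem mu_shift_eta : mu φ * shift φ (eta φ) = 1 :=
  ext_cons φ fun x => by
    have := mu_mul_cons₂ φ (x ⊗ₜ 1)
    simpa [eta, mul_assoc] using this

theorem mu_mul_cons (x y : B) : mu φ * (cons φ x * cons φ y) = cons φ (x * y) := by
  rw [← cons₂_tmul, mu_mul_cons₂]; simp

/-- Evaluating the compatibility of τ with 𝐦 on 1 ⊗ τ(w) and using τ² = 1 shows that τ₁ followed by
𝐦₂ sends 1 ⊗ w to w. The choice w = x ⊗ 1 isolates τ(1 ⊗ x). -/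
theorem tau_one_tmul {τ : B ⊗[k] B →ₗ[k] B ⊗[k] B} (h : IsBraidedAlgebra τ) (hτ : IsInvolutive τ)
    (x : B) : τ (1 ⊗ₜ x) = x ⊗ₜ 1 := by
  have h1 (w : B ⊗[k] B) : mulTwo k B (tauOne τ (1 ⊗ₜ w)) = w := by
    have h2 (z : B ⊗[k] B) : mulOne k B (1 ⊗ₜ z) = z := by
      induction z with
      | zero => simp
      | tmul a b => simp [mulOne]
      | add a b ha hb => simp only [TensorProduct.tmul_add, map_add, ha, hb]
    have h3 := LinearMap.congr_fun h.mul_left (1 ⊗ₜ τ w)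
    have h4 : τ (τ w) = w := LinearMap.congr_fun hτ w
    simpa [h2, tauTwo, h4] using h3.symm
  have h5 (z : B ⊗[k] B) : mulTwo k B (TensorProduct.assoc k B B B (z ⊗ₜ 1)) = z := by
    induction z with
    | zero => simp
    | tmul a b => simp [mulTwo]
    | add a b ha hb => simp only [TensorProduct.add_tmul, map_add, ha, hb]
  have := h1 (x ⊗ₜ 1)
  simpa [tauOne, h5] using this

theorem tau_tmul_one {τ : B ⊗[k] B →ₗ[k] B ⊗[k] B} (h : IsBraidedAlgebra τ) (hτ : IsInvolutive τ)
    (x : B) : τ (x ⊗ₜ 1) = 1 ⊗ₜ x := by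
  rw [← tau_one_tmul h hτ]
  exact LinearMap.congr_fun hτ _

theorem mul_braidedTensorMul (τ : B ⊗[k] B →ₗ[k] B ⊗[k] B) (z w : B ⊗[k] B) :
    shift φ (mu φ) * mu φ * shift φ (t φ τ) * (cons₂ φ z * cons₂ φ w) =
      cons₂ φ (braidedTensorMul τ (z ⊗ₜ w)) := by
  induction z with
  | zero => simp
  | add a b ha hb => simp only [TensorProduct.add_tmul, map_add, add_mul, mul_add, ha, hb]
  | tmul a b =>
    induction w with
    | zero => simp
    | add a b ha hb => simp only [TensorProduct.tmul_add, map_add, mul_add, ha, hb]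
    | tmul c e =>
      have h1 := t_mul_cons₂ φ τ (b ⊗ₜ c)
      rw [cons₂_tmul] at h1
      have h2 : shift φ (t φ τ) * (cons₂ φ (a ⊗ₜ b) * cons₂ φ (c ⊗ₜ e)) =
          cons φ a * (cons₂ φ (τ (b ⊗ₜ c)) * cons φ e) := by
        simp [mul_assoc, ← h1]
      rw [mul_assoc, h2]
      have h3 : braidedTensorMul τ ((a ⊗ₜ[k] b) ⊗ₜ[k] (c ⊗ₜ[k] e)) =
        TensorProduct.map (LinearMap.mul' k B) (LinearMap.mul' k B)
          ((TensorProduct.assoc k B B (B ⊗[k] B)).symm (a ⊗ₜ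
            TensorProduct.assoc k B B B (τ (b ⊗ₜ c) ⊗ₜ e))) := by
        simp [braidedTensorMul, tauOne]
      rw [h3]
      induction τ (b ⊗ₜ c) with
      | zero => simp
      | add x y hx hy =>
        simp only [TensorProduct.tmul_add, TensorProduct.add_tmul, map_add, add_mul, mul_add, hx, hy]
      | tmul x y =>
        have h4 := mu_mul_cons₂ φ (a ⊗ₜ x)
        have h5 := mu_mul_cons₂ φ (y ⊗ₜ e)
        simp only [cons₂_tmul, LinearMap.mul'_apply] at h4 h5
        simp only [cons₂_tmul, mul_assoc]
        rw [← mul_assoc (cons φ a), ← mul_assoc (mu φ), h4]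
        simp [h5]

variable [Coalgebra k B] (H : BraidedHopfAlgebra k B)

/-- The operator that divides the second strand by the first. -/
def q : Module.End k W := op₂ φ (cons φ ∘ₗ TensorProduct.lift H.ldiv)

theorem q_mul_cons (x y : B) : q φ H * (cons φ x * cons φ y) = cons φ (H.ldiv x y) := by
  rw [← cons₂_tmul, q, op₂_mul]; simp

theorem mu_q : mu φ * shift φ (q φ H) * d φ = eps φ :=
  ext_cons φ fun x => ext_cons φ fun y => by
    have h (z : B ⊗[k] B) : mu φ * (shift φ (q φ H) * (cons₂ φ z * cons φ y)) =
        cons φ (TensorProduct.lift ((LinearMap.mul k B).compl₂ (H.ldiv.flip y)) z) := by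
      induction z with
      | zero => simp
      | tmul a b => simp [mul_assoc, q_mul_cons, mu_mul_cons]
      | add a b ha hb => simp only [map_add, add_mul, mul_add, ha, hb]
    rw [mul_assoc, mul_assoc, mul_assoc, ← mul_assoc (d φ), d_mul_cons, h, H.mul_ldiv, eps_mul_cons]
    simp

theorem q_mu : q φ H * shift φ (mu φ) * d φ = eps φ :=
  ext_cons φ fun x => ext_cons φ fun y => by
    have h (z : B ⊗[k] B) : q φ H * (shift φ (mu φ) * (cons₂ φ z * cons φ y)) =
        cons φ (TensorProduct.lift (H.ldiv.compl₂ ((LinearMap.mul k B).flip y)) z) := by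
      induction z with
      | zero => simp
      | tmul a b => simp [mul_assoc, q_mul_cons, mu_mul_cons]
      | add a b ha hb => simp only [map_add, add_mul, mul_add, ha, hb]
    rw [mul_assoc, mul_assoc, mul_assoc, ← mul_assoc (d φ), d_mul_cons, h, H.ldiv_mul, eps_mul_cons]
    simp

/-- The strand diagrams of a braided nonassociative Hopf algebra, as operators on a module `W` with
`B ⊗ W ≃ W`. -/
def calculus (hτ : IsInvolutive H.braiding) : StrandCalculus (Module.End k W) where
  shift := shift φ
  t := t φ H.braiding
  mu := mu φ
  d := d φ
  eta := eta φ
  eps := eps φ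
  q := q φ H
  t_nat := op₂_cons₂_nat φ _
  mu_nat := op₂_cons_nat φ _
  q_nat := op₂_cons_nat φ _
  d_nat := op_cons₂_nat φ _
  eta_nat f := by simp [eta]
  eps_nat f := ext_cons φ fun x => by
    simp [mul_assoc, eps_mul_cons, ← mul_assoc (eps φ)]
  t_t := cons₂_ext φ fun z => by
    rw [mul_assoc, t_mul_cons₂, t_mul_cons₂, one_mul]
    exact congrArg _ (LinearMap.congr_fun hτ z)
  t_mu := cons₃_ext φ fun z => by
    simp only [mul_assoc, mu_mul_cons₃, shift_t_mul_cons₃, t_mul_cons₃, t_mul_cons₂,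
      shift_mu_mul_cons₃]
    exact congrArg _ (LinearMap.congr_fun H.isBraidedBialgebra.braidedAlgebra.mul_left z)
  t_shift_mu := cons₃_ext φ fun z => by
    simp only [mul_assoc, mu_mul_cons₃, shift_t_mul_cons₃, t_mul_cons₃, t_mul_cons₂,
      shift_mu_mul_cons₃]
    exact congrArg _ (LinearMap.congr_fun H.isBraidedBialgebra.braidedAlgebra.mul_right z)
  t_eta := ext_cons φ fun x => by
    have := t_mul_cons₂ φ H.braiding (1 ⊗ₜ x)
    rw [tau_one_tmul H.isBraidedBialgebra.braidedAlgebra hτ] at this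
    simpa [eta, mul_assoc] using this
  t_shift_eta := ext_cons φ fun x => by
    have := t_mul_cons₂ φ H.braiding (x ⊗ₜ 1)
    rw [tau_tmul_one H.isBraidedBialgebra.braidedAlgebra hτ] at this
    simpa [eta, mul_assoc] using this
  eps_t := cons₂_ext φ fun z => by
    rw [mul_assoc, t_mul_cons₂, eps_mul_cons₂, shift_eps_mul_cons₂]
    exact congrArg _ (LinearMap.congr_fun H.isBraidedBialgebra.braidedCoalgebra.counit_left z)
  shift_d_t := cons₂_ext φ fun z => by
    simp only [mul_assoc, t_mul_cons₂, shift_d_mul_cons₂, d_mul_cons₂, shift_t_mul_cons₃,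
      t_mul_cons₃]
    exact congrArg _ (LinearMap.congr_fun H.isBraidedBialgebra.braidedCoalgebra.comul_right z)
  d_t := cons₂_ext φ fun z => by
    simp only [mul_assoc, t_mul_cons₂, shift_d_mul_cons₂, d_mul_cons₂, shift_t_mul_cons₃,
      t_mul_cons₃]
    exact congrArg _ (LinearMap.congr_fun H.isBraidedBialgebra.braidedCoalgebra.comul_left z)
  d_d := d_d φ
  eps_d := eps_d φ
  shift_eps_d := shift_eps_d φ
  mu_eta := mu_eta φ
  mu_shift_eta := mu_shift_eta φ
  d_eta := by
    rw [eta, d_mul_cons, H.isBraidedBialgebra.comul_one, cons₂_tmul]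
  d_mu' := ext_cons φ fun x => ext_cons φ fun y => by
    have h : shift φ (shift φ (d φ)) * d φ * cons φ x * cons φ y =
        cons₂ φ (Coalgebra.comul (R := k) x) * cons₂ φ (Coalgebra.comul (R := k) y) := by
      rw [mul_assoc _ (d φ), d_mul_cons, shift_shift_mul, mul_assoc, d_mul_cons]
    have h2 := mul_braidedTensorMul φ H.braiding (Coalgebra.comul (R := k) x)
      (Coalgebra.comul (R := k) y)
    rw [← H.isBraidedBialgebra.comul_mul, ← h, ← d_mul_cons, ← mu_mul_cons] at h2
    simpa only [mul_assoc] using h2.symm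
  mu_q := mu_q φ H
  q_mu := q_mu φ H

end Hopf

end Strand

end BraidedNA

end

/-! ### Tensor powers and the operations on them as operators on W. -/

open scoped TensorProduct

namespace BraidedNA

theorem prod_ofFn_add {M : Type*} [Monoid M] {p q : ℕ} (g : Fin (p + q) → M) :
    (List.ofFn g).prod = (List.ofFn fun j : Fin p => g (j.castAdd q)).prod *
      (List.ofFn fun j : Fin q => g (j.natAdd p)).prod := by
  rw [List.ofFn_add, List.prod_append]
  rfl

namespace Strand

section Module

variable {k B W : Type*} [Field k] [AddCommGroup B] [Module k B] [AddCommGroup W] [Module k W]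
  (φ : B ⊗[k] W ≃ₗ[k] W)

/-- The operator that puts `n` strands in front. -/
noncomputable def consPow (n : ℕ) : ⨂[k]^n B →ₗ[k] Module.End k W :=
  (TensorAlgebra.lift k (cons φ)).toLinearMap ∘ₗ TensorPower.toTensorAlgebra

theorem consPow_tprod {n : ℕ} (x : Fin n → B) :
    consPow φ n (PiTensorProduct.tprod k x) = (List.ofFn fun i => cons φ (x i)).prod := by
  simp [consPow, TensorAlgebra.tprod_apply, map_list_prod, List.map_ofFn, Function.comp_def]

theorem consPow_splitTensor {N a b : ℕ} (h : N = a + b) (u : ⨂[k]^N B) :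
    consPow φ N u = LinearMap.mul' k _ (TensorProduct.map (consPow φ a) (consPow φ b)
      (splitTensor k B h u)) := by
  subst h
  have h1 (z : (⨂[k]^a B) ⊗[k] (⨂[k]^b B)) : consPow φ (a + b) (TensorPower.mulEquiv z) =
      LinearMap.mul' k _ (TensorProduct.map (consPow φ a) (consPow φ b) z) := by
    induction z with
    | zero => simp
    | tmul x y =>
      have := TensorPower.toTensorAlgebra_gMul x y
      rw [TensorPower.gMul_def] at this
      simp [consPow, this]
    | add x y hx hy => simp only [map_add, hx, hy]
  rw [← h1]
  simp [splitTensor]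

theorem pow_shift_mul_consPow (n : ℕ) (f : Module.End k W) (u : ⨂[k]^n B) :
    (shift φ ^ n : Module.End k W →+* _) f * consPow φ n u = consPow φ n u * f := by
  induction u using PiTensorProduct.induction_on with
  | smul_tprod c x =>
    rw [map_smul, mul_smul_comm, smul_mul_assoc, consPow_tprod]
    congr 1
    induction n with
    | zero => simp
    | succ n ih =>
      rw [List.ofFn_succ, List.prod_cons, pow_succ', RingHom.mul_def, RingHom.comp_apply,
        shift_mul_cons_mul, ih, mul_assoc]
  | add x y hx hy => rw [map_add, mul_add, add_mul, hx, hy]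

theorem t_mul_consPow (τ : B ⊗[k] B →ₗ[k] B ⊗[k] B) {n i : ℕ} (h1 : 1 ≤ i) (h2 : i < n)
    (u : ⨂[k]^n B) :
    consPow φ n (tauAt τ n i u) =
      (shift φ ^ (i - 1) : Module.End k W →+* _) (t φ τ) * consPow φ n u := by
  obtain ⟨p, rfl⟩ := Nat.exists_eq_add_of_le' h1
  -- The strands are cut into the `p` before the crossing, the two that cross, and the `q` after it.
  obtain ⟨q, rfl⟩ : ∃ q, n = p + (q + 2) := ⟨n - p - 2, by omega⟩
  rw [tauAt, dif_pos ⟨h1, h2⟩]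
  change consPow φ _ (applyAt τ (⟨p, by omega⟩ : Fin (p + (q + 2))) ⟨p + 1, h2⟩ (by simp) u) =
    (shift φ ^ p : Module.End k W →+* _) (t φ τ) * _
  induction u using PiTensorProduct.induction_on with
  | add x y hx hy => rw [map_add, map_add, hx, hy, map_add, mul_add]
  | smul_tprod c x =>
    rw [map_smul, map_smul, map_smul, mul_smul_comm]
    congr 1
    have h3 (y : Fin (p + (q + 2)) → B) : consPow φ _ (PiTensorProduct.tprod k y) =
        consPow φ p (PiTensorProduct.tprod k fun j => y (j.castAdd _)) *
          (cons φ (y ⟨p, by omega⟩) * (cons φ (y ⟨p + 1, by omega⟩) *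
            (List.ofFn fun j : Fin q => cons φ (y (j.succ.succ.natAdd p))).prod)) := by
      rw [consPow_tprod, prod_ofFn_add, List.ofFn_succ, List.ofFn_succ, List.prod_cons,
        List.prod_cons, consPow_tprod]
      rfl
    rw [h3, ← mul_assoc, pow_shift_mul_consPow, applyAt, PiTensorProduct.lift.tprod]
    have h4 (z : B ⊗[k] B) : consPow φ _ (insertPair (⟨p, by omega⟩ : Fin (p + (q + 2)))
        ⟨p + 1, by omega⟩ (by simp) x z) =
        consPow φ p (PiTensorProduct.tprod k fun j => x (j.castAdd _)) *
          (cons₂ φ z *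
            (List.ofFn fun j : Fin q => cons φ (x (j.succ.succ.natAdd p))).prod) := by
      induction z with
      | zero => simp
      | add a b ha hb => rw [map_add, map_add, ha, hb, map_add, add_mul, mul_add]
      | tmul a b =>
        rw [insertPair_tmul, h3, cons₂_tmul, mul_assoc]
        congr 3
        · ext j
          rw [Function.update_of_ne, Function.update_of_ne] <;>
            simp [Fin.ext_iff]
          all_goals omega
        · rw [Function.update_of_ne, Function.update_self]
          simp [Fin.ext_iff]
        · rw [Function.update_self]
        · congr 2
          ext j : 1
          rw [Function.update_of_ne, Function.update_of_ne] <;>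
            simp [Fin.ext_iff]
    refine (h4 _).trans ?_
    rw [← t_mul_cons₂, cons₂_tmul]
    simp only [mul_assoc]

/-- The rightmost block is processed first, so that each operator still finds all strands to its
left in place. -/
theorem cons₃_tensorThree {N a b c : ℕ} (e : N = a + (b + c)) {f : ⨂[k]^a B →ₗ[k] B}
    {g : ⨂[k]^b B →ₗ[k] B} {h : ⨂[k]^c B →ₗ[k] B} {F G H : Module.End k W}
    (hf : ∀ u, cons φ (f u) = F * consPow φ a u) (hg : ∀ u, cons φ (g u) = G * consPow φ b u)
    (hh : ∀ u, cons φ (h u) = H * consPow φ c u) (u : ⨂[k]^N B) :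
    cons₃ φ (tensorThree e f g h u) = F * ((shift φ ^ a : Module.End k W →+* _) G *
      ((shift φ ^ (a + b) : Module.End k W →+* _) H * consPow φ N u)) := by
  rw [tensorThree, LinearMap.comp_apply, consPow_splitTensor φ e]
  simp only [LinearEquiv.coe_coe]
  induction splitTensor k B e u with
  | zero => simp
  | add x y hx hy => simp only [map_add, mul_add, hx, hy]
  | tmul x y =>
    simp only [TensorProduct.map_tmul, cons₃_tmul, LinearMap.comp_apply, LinearMap.mul'_apply,
      LinearEquiv.coe_coe]
    rw [consPow_splitTensor φ rfl]
    have hs : (shift φ ^ (a + b) : Module.End k W →+* _) H =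
        (shift φ ^ a : Module.End k W →+* _) ((shift φ ^ b : Module.End k W →+* _) H) := by
      rw [pow_add]; rfl
    rw [hs, ← mul_assoc ((shift φ ^ a : Module.End k W →+* _) _) (consPow φ a x),
      pow_shift_mul_consPow, mul_assoc (consPow φ a x),
      ← mul_assoc ((shift φ ^ a : Module.End k W →+* _) _) (consPow φ a x),
      pow_shift_mul_consPow, mul_assoc (consPow φ a x), ← mul_assoc F, ← hf]
    congr 1
    induction splitTensor k B rfl y with
    | zero => simp
    | add x y hx hy => simp only [map_add, mul_add, hx, hy]
    | tmul z w =>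
      simp only [TensorProduct.map_tmul, cons₂_tmul, LinearMap.mul'_apply, hg, hh]
      rw [← mul_assoc ((shift φ ^ b : Module.End k W →+* _) _), pow_shift_mul_consPow]
      simp only [mul_assoc]

end Module

section Hopf

variable {k B W : Type*} [Field k] [NonAssocRing B] [Module k B] [SMulCommClass k B B]
  [IsScalarTower k B B] [AddCommGroup W] [Module k W] (φ : B ⊗[k] W ≃ₗ[k] W)

variable [Coalgebra k B] (H : BraidedHopfAlgebra k B) (hτ : IsInvolutive H.braiding)

theorem consPow_wordAction {n : ℕ} {w : List ℕ} (h : ∀ i ∈ w, 1 ≤ i ∧ i < n) (u : ⨂[k]^n B) :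
    consPow φ n (wordAction H.braiding n w u) = (calculus φ H hτ).act w * consPow φ n u := by
  induction w generalizing u with
  | nil => simp [wordAction, StrandCalculus.act]
  | cons i w ih =>
    obtain ⟨h1, h2⟩ := h i (by simp)
    rw [wordAction, LinearMap.comp_apply, ih fun j hj => h j (by simp [hj]),
      t_mul_consPow φ _ h1 h2, StrandCalculus.act, mul_assoc]
    rfl

theorem cons_rightNormed (r : ℕ) (u : ⨂[k]^r B) :
    cons φ (rightNormed k B r u) = (calculus φ H hτ).fold r * consPow φ r u := by
  induction u using PiTensorProduct.induction_on with
  | add x y hx hy => rw [map_add, map_add, hx, hy, map_add, mul_add]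
  | smul_tprod c x =>
    rw [map_smul, map_smul, map_smul, mul_smul_comm, consPow_tprod, rightNormed,
      PiTensorProduct.lift.tprod]
    congr 1
    induction r with
    | zero => simp [rightNormedMultilinear, StrandCalculus.fold, StrandCalculus.sh, calculus, eta]
    | succ r ih =>
      rw [rightNormedMultilinear, MultilinearMap.uncurryRight_apply, List.ofFn_succ_last,
        List.prod_append, List.prod_singleton, StrandCalculus.fold]
      change cons φ (rightNormedMultilinear k B r (Fin.init x) * x (Fin.last r)) = _
      rw [← mu_mul_cons, ih (Fin.init x)]
      simp only [mul_assoc]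
      rfl

theorem cons_associatorMap (z : B ⊗[k] (B ⊗[k] B)) :
    cons φ (associatorMap k B z) = (calculus φ H hτ).assoc * cons₃ φ z := by
  rw [associatorMap, LinearMap.comp_apply, ← mu_mul_cons₂, LinearMap.sub_apply, map_sub,
    ← mu_mul_cons₃, ← shift_mu_mul_cons₃, ← sub_mul, ← mul_assoc]
  simp [StrandCalculus.assoc, StrandCalculus.sh, calculus]

/-- The recursions for `suOp` and `suDiagram` correspond term by term, so strong induction on m + n
transfers one to the other. -/
theorem cons_suOp (m n : ℕ) (u : ⨂[k]^(m + n + 1) B) :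
    cons φ (suOp H.braiding m n u) = (calculus φ H hτ).suDiagram m n * consPow φ _ u := by
  obtain ⟨N, hN⟩ : ∃ N, N = m + n := ⟨_, rfl⟩
  induction N using Nat.strong_induction_on generalizing m n with
  | _ N ih =>
    subst hN
    have h1 (z : ⨂[k]^1 B) :
        cons φ ((PiTensorProduct.subsingletonEquiv (R := k) (s := fun _ => B) (0 : Fin 1)).toLinearMap z) =
        1 * consPow φ 1 z := by
      rw [one_mul]
      induction z using PiTensorProduct.induction_on with
      | smul_tprod c x => simp [consPow_tprod]
      | add x y hx hy => rw [map_add, map_add, hx, hy, map_add]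
    rw [suOp, StrandCalculus.suDiagram, LinearMap.sub_apply, map_sub, sub_mul]
    congr 1
    · rw [LinearMap.comp_apply, cons_associatorMap φ H hτ,
        cons₃_tensorThree φ _ (cons_rightNormed φ H hτ m) (cons_rightNormed φ H hτ n) h1]
      simp only [map_one, one_mul, mul_assoc]
      rfl
    · simp only [LinearMap.sum_apply, map_sum, Finset.sum_mul]
      refine Finset.sum_congr rfl fun r _ => Finset.sum_congr rfl fun s _ => ?_
      split_ifs with hrs
      · simp only [LinearMap.sum_apply, map_sum, Finset.sum_mul]
        refine Finset.sum_congr rfl fun π _ => Finset.sum_congr rfl fun σ _ => ?_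
        simp only [LinearMap.comp_apply]
        rw [← mu_mul_cons₂, ← mu_mul_cons₃,
          cons₃_tensorThree φ _ (cons_rightNormed φ H hτ r) (cons_rightNormed φ H hτ s)
            (fun u => ih (m - r + (n - s)) (by omega) (m - r) (n - s) u rfl),
          consPow_wordAction φ H hτ]
        · simp only [mul_assoc]
          rfl
        · intro i hi
          have := StrandCalculus.mem_pairWord r.2.le s.2.le hi
          omega
      · simp

theorem prim_mul_cons (x : B) : (calculus φ H hτ).prim * cons φ x =
    cons₂ φ (Coalgebra.comul (R := k) x - (x ⊗ₜ 1 + 1 ⊗ₜ x)) := by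
  have h : (calculus φ H hτ).prim = d φ - eta φ - shift φ (eta φ) := rfl
  rw [h, sub_mul, sub_mul, d_mul_cons, shift_mul_cons, map_sub, map_add, cons₂_tmul, cons₂_tmul, eta]
  abel

theorem isPrim_consPow {n : ℕ} {x : Fin n → B} (hx : ∀ i, IsPrimitive k (x i)) :
    (calculus φ H hτ).IsPrim 0 n (consPow φ n (PiTensorProduct.tprod k x)) := by
  intro i _ hi
  obtain ⟨q, rfl⟩ : ∃ q, n = i + (q + 1) := ⟨n - i - 1, by omega⟩
  rw [consPow_tprod, prod_ofFn_add, List.ofFn_succ, List.prod_cons, ← consPow_tprod, ← mul_assoc,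
    StrandCalculus.sh]
  have h := pow_shift_mul_consPow φ i (calculus φ H hτ).prim
    (PiTensorProduct.tprod k fun j => x (j.castAdd _))
  have h2 := hx (Fin.natAdd i 0)
  rw [IsPrimitive] at h2
  have h3 : (calculus φ H hτ).prim * cons φ (x (Fin.natAdd i 0)) = 0 := by
    rw [prim_mul_cons, h2, sub_self, map_zero]
  refine (congrArg (· * _) h).trans ?_
  rw [mul_assoc, ← mul_assoc _ (cons φ _), h3, zero_mul, mul_zero]

theorem isPrimitive_of_prim_mul [Nontrivial W] {x : B}
    (h : (calculus φ H hτ).prim * cons φ x = 0) : IsPrimitive k x := by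
  rw [prim_mul_cons, map_eq_zero_iff _ (cons₂_injective φ), sub_eq_zero] at h
  exact h

end Hopf

/-- There is a nonzero module `W` with `B ⊗ W ≃ W`. -/
theorem exists_tensor_equiv_self.{u, v} (k : Type u) {B : Type v} [Field k] [AddCommGroup B] [Module k B]
    [Nontrivial B] : ∃ (ι : Type v) (_ : Nonempty ι), Nonempty (B ⊗[k] (ι →₀ k) ≃ₗ[k] (ι →₀ k)) := by
  let b := Module.Basis.ofVectorSpace k B
  let κ := Module.Basis.ofVectorSpaceIndex k B
  have : Nonempty κ := b.index_nonempty
  -- W has as basis the infinite sequences of basis indices of B, and tensoring with B prepends one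
  -- more index.
  let e : κ × Stream' κ ≃ Stream' κ :=
    { toFun := fun p => Stream'.cons p.1 p.2
      invFun := fun s => (s.head, s.tail)
      left_inv := fun p => rfl
      right_inv := fun s => Stream'.eta s }
  exact ⟨Stream' κ, ⟨Stream'.const (Classical.arbitrary κ)⟩,
    ⟨((TensorProduct.congr b.repr (LinearEquiv.refl k _)).trans
      (finsuppTensorFinsupp' k κ (Stream' κ))).trans (Finsupp.domLCongr e)⟩⟩

end Strand

end BraidedNA

theorem theorem6p1 {k : Type*} [Field k] [CharZero k] {B : Type*} [NonAssocRing B] [Module k B]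
    [SMulCommClass k B B] [IsScalarTower k B B] [Coalgebra k B]
    (H : BraidedNA.BraidedHopfAlgebra k B) (hτ : BraidedNA.IsInvolutive H.braiding)
    (m n : ℕ) (hm : 1 ≤ m) (hn : 1 ≤ n) :
    BraidedNA.IsPrimitiveOperation (BraidedNA.suOp H.braiding m n) := by
  intro u hu
  -- For B = 0 there is no nonzero W with B ⊗ W ≃ W, but every element of B is then primitive.
  obtain _ | _ := subsingleton_or_nontrivial B
  · have h : Subsingleton (TensorProduct k B B) := inferInstance
    exact h.elim _ _
  · obtain ⟨ι, _, ⟨φ⟩⟩ := BraidedNA.Strand.exists_tensor_equiv_self k (B := B)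
    refine BraidedNA.Strand.isPrimitive_of_prim_mul φ H hτ ?_
    rw [BraidedNA.Strand.cons_suOp φ H hτ]
    exact (BraidedNA.Strand.calculus φ H hτ).prim_suDiagram m n hm hn
      (BraidedNA.Strand.isPrim_consPow φ H hτ hu)
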